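/- **Setting.** Consider first-order call-by-value programs over $\mathtt{Bool}$, $\mathtt{Int}$ and user-defined algebraic datatypes (each with finitely many constructors). A function $\mathtt{fix}\,f.\lambda x_1\cdots\lambda x_n.\,t$ of type $x_1:\tau_1\to\dots\to x_n:\tau_n\to\tau$ (with $\tau_i,\tau$ refinements $\{B\mid\varphi\}$ of ordinary types $B$) has a body $t$ built from variables, constants, constructor applications, calls of auxiliary functions, recursive calls of $f$, $\mathtt{if}$ and $\mathtt{match}$; guards, scrutinees and arguments contain no $\mathtt{if}$ or $\mathtt{match}$. All variable and function names are distinct. Resources are used only by $\mathtt{tick}(c,\cdot)$ in the implementations of the auxiliary functions, where it uses $c$ units. Every function $g$ has a size function $\mathrm{size}_g$ from its inputs to $\mathbb N$. The *complexity function* of a function that reduces to a value on every possible input is the function $T:\mathbb N\to\mathbb N$ (if it exists, i.e. if all the suprema are finite) such that $T(u)$ is the supremum of the resource usages over all inputs of size $u$. For $g,h:\mathbb N\to\mathbb R$, $g\in O(h)$ means $\exists c,M\ge 0\ \forall x\ge c:\ g(x)\le M\,h(x)$. Each auxiliary function $g$ has a signature $\langle x_1:\tau^g_1\to\dots\to\{B\mid\varphi_g\};O(\psi_g)\rangle$,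 and is implemented by some closed function term that reduces to a value on every possible input, whose outputs satisfy the refinement $\varphi_g$, and whose complexity function exists and lies in $O(\psi_g)$. A *recurrence annotation* is $([c_1,\phi_1],\dots,[c_m,\phi_m];O(\psi))$ with $c_i\in\mathbb N$, size expressions $\phi_i$ (integer-valued functions of $u$) and a bound expression $\psi(u)=u^a\log^b u+c$ with constants $a,b,c\ge0$. The typing judgment $\Gamma\vdash t::\langle\tau;\alpha\rangle$ is defined by the following rules; $\Gamma\models\cdot$ means validity for all instances of $\Gamma$, i.e. all valuations that satisfy its typed variable bindings and its path conditions, and $u$ stands for the size $\mathrm{size}_f(x_1,\dots,x_n)$ of the arguments of $f$. * *Variables and constants* have their (singleton) refinement type and the annotation $([\,];O(1))$. * *Sharing.* $\alpha$ is shared among $\alpha_1,\dots,\alpha_k$ if these have the size expressions and the bound of $\alpha$, and for each size expression the numbers of calls in the $\alpha_j$ add up to at most that in $\alpha$. * *Applications.* An application with the annotation $([c_1,\phi_1],\dots,[c_m,\phi_m];O(\psi))$ shares it among its arguments $e_i::\{B_i\mid\varphi_i\}$, whose refinements have to imply those of the parameters. A call of an auxiliary $g$ requires in addition that $\psi_g(\mathrm{size}_g(y_1,\dots,y_k))\in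 O(\psi(u))$, uniformly over all instances of $\Gamma$ and all $y_i$ satisfying $\varphi_i$. A recursive call $f\,e_1\cdots e_n$ requires $\Gamma\models\bigwedge_i\varphi_i(y_i)\Rightarrow \mathrm{size}_f(y_1,\dots,y_n)\le\phi_k(u)$ for some $k$, and in its own annotation $c_k$ is replaced by $c_k+1$. The result type is the refinement of the result of the called function at some arguments satisfying the $\varphi_i$. Constructor applications $C\,e_1\cdots e_k$ are treated in the same way, without a condition on costs. * *Branching.* For $\mathtt{if}$ and $\mathtt{match}$ the annotation is shared between $\alpha_1$ for the guard or scrutinee and $\alpha_2$ for the branches; every branch has the type of the whole term and the annotation $\alpha_2$, under the path condition given by the refinement of the guard (or scrutinee) at the value $\mathtt{true}$, $\mathtt{false}$ (or $C(\overline y)$, where the variables $\overline y$ bound by the branch of $C$ have the argument types of $C$). * *Subtyping* (for terms other than $\mathtt{if}$ and $\mathtt{match}$). Refinements, numbers of calls $c_i$, size expressions $\phi_i$ and the bound $O(\psi)$ may be weakened, as justified by $\Gamma$; calls of equal size may be split or combined, costs $[c,\phi]$ may be added, and the order of the calls is irrelevant. Function types are contravariant in the arguments and covariant in the result and the bound.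 **Lemma.** Let $\mathtt{fix}\,f.\lambda x_1\cdots\lambda x_n.\,t$ be a function of type $x_1:\tau_1\to\dots\to x_n:\tau_n\to\tau$, and let $\Gamma$ be the environment consisting of the signatures of the auxiliary functions, $x_i:\tau_i$, and $f:(x_1:\tau_1\to\dots\to x_n:\tau_n\to\tau)$. Suppose that $$\Gamma\vdash t::\langle\tau;([c_1,\phi_1],\dots,[c_m,\phi_m];O(\psi))\rangle .$$ If the complexity function $T_f:\mathbb N\to\mathbb N$ of $f$ exists and is monotone, then it satisfies the recurrence relation $$T_f(u)\le c_1T_f(\phi_1)+\dots+c_mT_f(\phi_m)+O(\psi),$$ that is, there is $h:\mathbb N\to\mathbb N$ with $h\in O(\psi)$ and $$T_f(u)\le\sum_{i=1}^m c_i\,T_f(\phi_i(u))+h(u)\qquad\text{for all }u\in\mathbb N,$$ where $T_f$ is extended by $0$ to negative integers. -/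

import Mathlib

open scoped NNReal

namespace SynPlexity

/-- Names of program variables and of functions. -/
abbrev Var := ℕ

/-! ### Ordinary types, datatypes and values -/

/-- Names and shapes of user-defined algebraic datatypes: every datatype has finitely many
constructors, each of them with a number of arguments. -/
structure DataSig where
  Data : Type
  Ctor : Data → Type
  finite_ctor : ∀ d, Finite (Ctor d)
  arity : ∀ {d : Data}, Ctor d → ℕ

/-- Ordinary types `B ::= Bool | Int | D`. -/
inductive Base (S : DataSig) : Type
  | bool : Base S
  | int : Base S
  | data (d : S.Data) : Base S

/-- (First-order) values. -/
inductive Val (S : DataSig) : Type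
  | bool (b : Bool) : Val S
  | int (n : ℤ) : Val S
  | con {d : S.Data} (c : S.Ctor d) (args : Fin (S.arity c) → Val S) : Val S

/-- Declarations of the datatypes: a constructor `C` with arguments `z_1, …, z_n` is a function of
type `z_1 : {B_1 | φ_1} → … → z_n : {B_n | φ_n} → D`; here `B_j = argBase C j` and
`φ_j = argRef C j`, a predicate on the tuple `z` (the value refined by `φ_j` is `z j`). -/
structure DataDecl extends DataSig where
  argBase : ∀ {d : Data} (c : Ctor d), Fin (arity c) → Base toDataSig
  argRef : ∀ {d : Data} (c : Ctor d), Fin (arity c) → (Fin (arity c) → Val toDataSig) → Prop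

/-- `L.HasBase v B`: the value `v` inhabits the ordinary type `B`. -/
def DataDecl.HasBase (L : DataDecl) : Val L.toDataSig → Base L.toDataSig → Prop
  | .bool _, B => B = .bool
  | .int _, B => B = .int
  | .con (d := d) c zs, B =>
      B = .data d ∧ (∀ j, L.HasBase (zs j) (L.argBase c j)) ∧ ∀ j, L.argRef c j zs

/-! ### Terms and their concrete-cost semantics -/

/-- Primitive integer operations, available to implementations of auxiliary functions. -/
inductive PrimOp : Type
  | add | sub | mul | div | mod | eq | le

/-- The terms of the language.  `tick`, `op` and nested `fix` occur only in implementations of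
auxiliary functions: no typing rule for function bodies accepts them. A `match` on a value of
datatype `d` has one branch `br c` for every constructor `c` of `d`, binding the variables
`ys c`. -/
inductive Term (S : DataSig) : Type
  | var (x : Var) : Term S
  | int (n : ℤ) : Term S
  | bool (b : Bool) : Term S
  | con {d : S.Data} (c : S.Ctor d) (args : Fin (S.arity c) → Term S) : Term S
  | app (h : Term S) {n : ℕ} (args : Fin n → Term S) : Term S
  | ite (e t₁ t₂ : Term S) : Term S
  | mtch (d : S.Data) (e : Term S) (ys : (c : S.Ctor d) → Fin (S.arity c) → Var)
      (br : S.Ctor d → Term S) : Term S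
  | fix (f : Var) {n : ℕ} (xs : Fin n → Var) (t : Term S) : Term S
  | tick (c : ℕ) (t : Term S) : Term S
  | op (o : PrimOp) (t₁ t₂ : Term S) : Term S

/-- A value, as a term. -/
def Val.toTerm {S : DataSig} : Val S → Term S
  | .bool b => .bool b
  | .int n => .int n
  | .con c zs => .con c (fun j => (zs j).toTerm)

/-- The result of a primitive operation. -/
def PrimOp.eval {S : DataSig} : PrimOp → ℤ → ℤ → Val S
  | .add, a, b => .int (a + b)
  | .sub, a, b => .int (a - b)
  | .mul, a, b => .int (a * b)
  | .div, a, b => .int (a / b)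
  | .mod, a, b => .int (a % b)
  | .eq, a, b => .bool (decide (a = b))
  | .le, a, b => .bool (decide (a ≤ b))

/-- Finite or infinite simultaneous substitutions; `none` leaves a variable unchanged. -/
abbrev Subst (S : DataSig) := Var → Option (Term S)

open Classical in
/-- The restriction of a substitution to the variables outside of `X`. -/
noncomputable def Subst.without {S : DataSig} (σ : Subst S) (X : Set Var) : Subst S :=
  fun y => if y ∈ X then none else σ y

open Classical in
/-- The substitution of the values `vs` for the variables `xs`. -/
noncomputable def Subst.ofVals {S : DataSig} {n : ℕ} (xs : Fin n → Var) (vs : Fin n → Val S) :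
    Subst S :=
  fun y => if h : ∃ i, xs i = y then some (vs h.choose).toTerm else none

/-- Substitution. It is only ever used with closed terms, so that no variable can be captured. -/
noncomputable def Term.subst {S : DataSig} : Term S → Subst S → Term S
  | .var x, σ => (σ x).getD (.var x)
  | .int n, _ => .int n
  | .bool b, _ => .bool b
  | .con c args, σ => .con c (fun j => (args j).subst σ)
  | .app h args, σ => .app (h.subst σ) (fun i => (args i).subst σ)
  | .ite e t₁ t₂, σ => .ite (e.subst σ) (t₁.subst σ) (t₂.subst σ)
  | .mtch d e ys br, σ =>
      .mtch d (e.subst σ) ys (fun c => (br c).subst (σ.without (Set.range (ys c))))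
  | .fix f xs t, σ => .fix f xs (t.subst (σ.without (insert f (Set.range xs))))
  | .tick c t, σ => .tick c (t.subst σ)
  | .op o t₁ t₂, σ => .op o (t₁.subst σ) (t₂.subst σ)

/-- Free variables. -/
def Term.fv {S : DataSig} : Term S → Set Var
  | .var x => {x}
  | .int _ => ∅
  | .bool _ => ∅
  | .con _ args => ⋃ j, (args j).fv
  | .app h args => h.fv ∪ ⋃ i, (args i).fv
  | .ite e t₁ t₂ => e.fv ∪ t₁.fv ∪ t₂.fv
  | .mtch _ e ys br => e.fv ∪ ⋃ c, ((br c).fv \ Set.range (ys c))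
  | .fix f xs t => t.fv \ insert f (Set.range xs)
  | .tick _ t => t.fv
  | .op _ t₁ t₂ => t₁.fv ∪ t₂.fv

/-- The substitution `[(fix f. λ xs. t) / f][vs / xs]`. -/
noncomputable def Subst.unfold {S : DataSig} (f : Var) {n : ℕ} (xs : Fin n → Var) (t : Term S)
    (vs : Fin n → Val S) : Subst S :=
  fun y => (Subst.ofVals xs vs y).orElse
    (fun _ => if y = f then some (.fix f xs t) else none)

/-- One step `⟨t, C⟩ ↪ ⟨t', C + C_Δ⟩` of the concrete-cost semantics (call by value, arguments from
left to right). Resources are used by `tick` only. -/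
inductive Step {S : DataSig} : Term S × ℕ → Term S × ℕ → Prop
  | tick (c : ℕ) (t : Term S) (C : ℕ) : Step (.tick c t, C) (t, C + c)
  | app (f : Var) {n : ℕ} (xs : Fin n → Var) (t : Term S) (vs : Fin n → Val S) (C : ℕ) :
      Step (.app (.fix f xs t) (fun i => (vs i).toTerm), C) (t.subst (.unfold f xs t vs), C)
  | appArg (f : Var) {n m : ℕ} (xs : Fin n → Var) (t : Term S) (args : Fin m → Term S) (i : Fin m)
      (hval : ∀ j < i, ∃ v : Val S, args j = v.toTerm) (t' : Term S) (C Δ : ℕ)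
      (h : Step (args i, 0) (t', Δ)) :
      Step (.app (.fix f xs t) args, C) (.app (.fix f xs t) (Function.update args i t'), C + Δ)
  | conArg {d : S.Data} (c : S.Ctor d) (args : Fin (S.arity c) → Term S) (i : Fin (S.arity c))
      (hval : ∀ j < i, ∃ v : Val S, args j = v.toTerm) (t' : Term S) (C Δ : ℕ)
      (h : Step (args i, 0) (t', Δ)) :
      Step (.con c args, C) (.con c (Function.update args i t'), C + Δ)
  | iteTrue (t₁ t₂ : Term S) (C : ℕ) : Step (.ite (.bool true) t₁ t₂, C) (t₁, C)
  | iteFalse (t₁ t₂ : Term S) (C : ℕ) : Step (.ite (.bool false) t₁ t₂, C) (t₂, C)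
  | iteGuard (e e' t₁ t₂ : Term S) (C Δ : ℕ) (h : Step (e, 0) (e', Δ)) :
      Step (.ite e t₁ t₂, C) (.ite e' t₁ t₂, C + Δ)
  | mtch {d : S.Data} (c : S.Ctor d) (zs : Fin (S.arity c) → Val S)
      (ys : (c : S.Ctor d) → Fin (S.arity c) → Var) (br : S.Ctor d → Term S) (C : ℕ) :
      Step (.mtch d (Val.con c zs).toTerm ys br, C) ((br c).subst (.ofVals (ys c) zs), C)
  | mtchScrutinee (d : S.Data) (e e' : Term S) (ys : (c : S.Ctor d) → Fin (S.arity c) → Var)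
      (br : S.Ctor d → Term S) (C Δ : ℕ) (h : Step (e, 0) (e', Δ)) :
      Step (.mtch d e ys br, C) (.mtch d e' ys br, C + Δ)
  | op (o : PrimOp) (a b : ℤ) (C : ℕ) :
      Step (.op o (.int a) (.int b), C) ((o.eval a b : Val S).toTerm, C)
  | opLeft (o : PrimOp) (t₁ t₁' t₂ : Term S) (C Δ : ℕ) (h : Step (t₁, 0) (t₁', Δ)) :
      Step (.op o t₁ t₂, C) (.op o t₁' t₂, C + Δ)
  | opRight (o : PrimOp) (a : ℤ) (t₂ t₂' : Term S) (C Δ : ℕ) (h : Step (t₂, 0) (t₂', Δ)) :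
      Step (.op o (.int a) t₂, C) (.op o (.int a) t₂', C + Δ)

/-- `t` evaluates to the value `v` with resource usage `C`: `⟨t, 0⟩ ↪* ⟨v, C⟩`. -/
def Term.Evals {S : DataSig} (t : Term S) (v : Val S) (C : ℕ) : Prop :=
  Relation.ReflTransGen Step (t, 0) (v.toTerm, C)

/-! ### Recurrence annotations and function types -/

/-- `g ∈ O(f)`. -/
def IsBigO (g f : ℕ → ℝ) : Prop :=
  ∃ (c : ℕ) (M : ℝ), 0 ≤ M ∧ ∀ x, c ≤ x → g x ≤ M * f x

/-- Bound expressions `u ^ a * log ^ b u + c` with non-negative constants. -/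
structure BoundExpr where
  a : ℝ≥0
  b : ℝ≥0
  c : ℝ≥0

noncomputable def BoundExpr.eval (ψ : BoundExpr) (u : ℕ) : ℝ :=
  (u : ℝ) ^ (ψ.a : ℝ) * Real.log u ^ (ψ.b : ℝ) + ψ.c

/-- The bound expression `u ^ 0 * log ^ 0 u + 0`, which is `1`. -/
def BoundExpr.one : BoundExpr := ⟨0, 0, 0⟩

/-- Size expressions in the size `u` of the top-level problem, given by their values.
The value may be negative, as that of `u - 1` at `u = 0`. -/
abbrev SizeExpr := ℕ → ℤ

/-- A recurrence annotation `([c_1, φ_1], …, [c_m, φ_m]; O(ψ))`. -/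
structure Ann where
  calls : List (ℕ × SizeExpr)
  bound : BoundExpr

/-- `α ⋎ α_1 | … | α_m`: the parts have the size expressions and the bound of `α`, and for every
size expression the numbers of calls in the parts add up to at most the number in `α`. -/
def Ann.Shares (α : Ann) {m : ℕ} (αs : Fin m → Ann) : Prop :=
  (∀ j, (αs j).bound = α.bound ∧ (αs j).calls.map Prod.snd = α.calls.map Prod.snd) ∧
  ∀ k : ℕ, ∑ j, ((αs j).calls.map Prod.fst).getD k 0 ≤ (α.calls.map Prod.fst).getD k 0

/-- An annotated function type
`⟨x_1 : {B_1 | φ_1} → … → x_n : {B_n | φ_n} → {B | φ}; O(ψ)⟩` together with the size function of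
the function. `argRef i` is `φ_i`, a predicate on the tuple of the arguments (the value refined by
it is the `i`-th one); `resRef` is `φ`, a predicate on the arguments and the result. Refinements
are given by the predicates that they denote. -/
structure FnType (S : DataSig) (n : ℕ) where
  argBase : Fin n → Base S
  argRef : Fin n → (Fin n → Val S) → Prop
  resBase : Base S
  resRef : (Fin n → Val S) → Val S → Prop
  size : (Fin n → Val S) → ℕ
  bound : BoundExpr

section Complexity

variable (L : DataDecl) {n : ℕ}

/-- The possible inputs of a function of type `F`: tuples of values of the argument types. -/
def FnType.IsInput (F : FnType L.toDataSig n) (zs : Fin n → Val L.toDataSig) : Prop :=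
  (∀ i, L.HasBase (zs i) (F.argBase i)) ∧ ∀ i, F.argRef i zs

/-- `T` is the complexity function of the function term `p` of type `F`: `p` reduces to a value on
every possible input, and `T u` is the supremum of the resource usages of `p` on the inputs of
size `u`. -/
def IsComplexity (F : FnType L.toDataSig n) (p : Term L.toDataSig) (T : ℕ → ℕ) : Prop :=
  (∀ zs, F.IsInput L zs → ∃ v C, (Term.app p (fun i => (zs i).toTerm)).Evals v C) ∧
  ∀ u, IsLUB {C | ∃ zs, F.IsInput L zs ∧ F.size zs = u ∧
    ∃ v, (Term.app p (fun i => (zs i).toTerm)).Evals v C} (T u)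

/-- `p` is an implementation of an auxiliary function with the signature `G`: a closed function
term whose outputs satisfy the refinement of the result, and whose complexity is bounded by the
bound of `G`. -/
def FnType.Implements (G : FnType L.toDataSig n) (p : Term L.toDataSig) : Prop :=
  (∃ (g : Var) (ys : Fin n → Var) (t : Term L.toDataSig), p = .fix g ys t) ∧ p.fv = ∅ ∧
  (∀ zs, G.IsInput L zs → ∀ v C, (Term.app p (fun i => (zs i).toTerm)).Evals v C →
    L.HasBase v G.resBase ∧ G.resRef zs v) ∧
  ∃ T : ℕ → ℕ, IsComplexity L G p T ∧ IsBigO (fun u => (T u : ℝ)) G.bound.eval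

end Complexity

/-! ### Environments and subtyping -/

abbrev Valuation (S : DataSig) := Var → Val S

/-- A refinement type `{B | φ}`; `φ` is a predicate on the values of the program variables and on
the reserved variable `v`. -/
structure RType (S : DataSig) where
  base : Base S
  ref : Valuation S → Val S → Prop

/-- Environments: signatures of the auxiliary functions, the function `recFun` that is being
checked with its type and its tuple `args` of arguments, bindings of variables (all with the
annotation `O(1)`), and path conditions. -/
structure Env (S : DataSig) where
  aux : Var → Option (Σ n, FnType S n)
  recFun : Var
  recArity : ℕ
  recTy : FnType S recArity
  args : Fin recArity → Var
  vars : List (Var × RType S)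
  path : List (Valuation S → Prop)

namespace Env

variable {S : DataSig} (Γ : Env S)

/-- The names that are in use. -/
def dom : Set Var :=
  {y | y = Γ.recFun ∨ (Γ.aux y).isSome ∨ y ∈ Γ.vars.map Prod.fst}

/-- The size of the top-level problem, `size Γ(args)`. -/
def size (ρ : Valuation S) : ℕ := Γ.recTy.size (fun i => ρ (Γ.args i))

/-- Adds a path condition. -/
def assume (p : Valuation S → Prop) : Env S := { Γ with path := p :: Γ.path }

/-- Adds bindings of variables. -/
def bind (bs : List (Var × RType S)) : Env S := { Γ with vars := bs ++ Γ.vars }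

end Env

/-- The bindings `x_1 : {B_1 | φ_1}, …, x_n : {B_n | φ_n}` of a tuple of variables, where `φ_i` is
a predicate on the whole tuple. -/
def bindings {S : DataSig} {n : ℕ} (xs : Fin n → Var) (base : Fin n → Base S)
    (ref : Fin n → (Fin n → Val S) → Prop) : List (Var × RType S) :=
  List.ofFn fun i =>
    (xs i, ⟨base i, fun ρ v => ref i (Function.update (fun j => ρ (xs j)) i v)⟩)

section Typing

variable (L : DataDecl)

/-- The instances of an environment; `Γ ⊨ φ` says that `φ` holds for all of them. -/
def Env.Inst (Γ : Env L.toDataSig) (ρ : Valuation L.toDataSig) : Prop :=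
  (∀ b ∈ Γ.vars, L.HasBase (ρ b.1) b.2.base ∧ b.2.ref ρ (ρ b.1)) ∧ ∀ p ∈ Γ.path, p ρ

/-- `Γ ⊢ {B | φ} <: {B | φ'}`. -/
def RType.Sub (Γ : Env L.toDataSig) (τ τ' : RType L.toDataSig) : Prop :=
  τ.base = τ'.base ∧
  ∀ ρ, Γ.Inst L ρ → ∀ v, L.HasBase v τ.base → τ.ref ρ v → τ'.ref ρ v

/-- Subtyping of function types: contravariant in the arguments, covariant in the result and in
the bound. -/
def FnType.Sub (Γ : Env L.toDataSig) {n : ℕ} (G G' : FnType L.toDataSig n) : Prop :=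
  G.argBase = G'.argBase ∧ G.resBase = G'.resBase ∧ G.size = G'.size ∧
  IsBigO G.bound.eval G'.bound.eval ∧
  ∀ ρ, Γ.Inst L ρ → ∀ zs, G'.IsInput L zs →
    G.IsInput L zs ∧ ∀ v, L.HasBase v G.resBase → G.resRef zs v → G'.resRef zs v

/-- Subtyping of recurrence annotations: larger numbers of calls, larger sub-problems and larger
bounds (`Γ ⊨ ψ ∈ O(ψ')`); splitting and combining calls of the same size; additional calls.
The calls form a (multi)set, so their order does not matter. -/
inductive Ann.Sub (Γ : Env L.toDataSig) : Ann → Ann → Prop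
  | mono {cs cs' : List (ℕ × SizeExpr)} {ψ ψ' : BoundExpr}
      (hcs : List.Forall₂ (fun p q => p.1 ≤ q.1 ∧
        ∀ ρ, Γ.Inst L ρ → p.2 (Γ.size ρ) ≤ q.2 (Γ.size ρ)) cs cs')
      (hψ : ∃ (c : ℕ) (M : ℝ), 0 ≤ M ∧ ∀ ρ, Γ.Inst L ρ → c ≤ Γ.size ρ →
        ψ.eval (Γ.size ρ) ≤ M * ψ'.eval (Γ.size ρ)) :
      Ann.Sub Γ ⟨cs, ψ⟩ ⟨cs', ψ'⟩
  | split {c₁ c₂ : ℕ} {φ₁ φ₂ : SizeExpr} {cs : List (ℕ × SizeExpr)} {ψ : BoundExpr}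
      (hφ : ∀ ρ, Γ.Inst L ρ → φ₁ (Γ.size ρ) = φ₂ (Γ.size ρ)) :
      Ann.Sub Γ ⟨(c₁ + c₂, φ₁) :: cs, ψ⟩ ⟨(c₁, φ₁) :: (c₂, φ₂) :: cs, ψ⟩
  | combine {c₁ c₂ : ℕ} {φ₁ φ₂ : SizeExpr} {cs : List (ℕ × SizeExpr)} {ψ : BoundExpr}
      (hφ : ∀ ρ, Γ.Inst L ρ → φ₁ (Γ.size ρ) = φ₂ (Γ.size ρ)) :
      Ann.Sub Γ ⟨(c₁, φ₁) :: (c₂, φ₂) :: cs, ψ⟩ ⟨(c₁ + c₂, φ₁) :: cs, ψ⟩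
  | weaken {c : ℕ} {φ : SizeExpr} {cs : List (ℕ × SizeExpr)} {ψ : BoundExpr} :
      Ann.Sub Γ ⟨cs, ψ⟩ ⟨(c, φ) :: cs, ψ⟩
  | perm {cs cs' : List (ℕ × SizeExpr)} {ψ : BoundExpr} (h : cs.Perm cs') :
      Ann.Sub Γ ⟨cs, ψ⟩ ⟨cs', ψ⟩

/-- The hypothesis `⋀ i, [y_i / v] φ_i` of the application rules, for values `ys` of the types
`{B_i | φ_i}`. -/
def ArgsOf {n : ℕ} (base : Fin n → Base L.toDataSig)
    (φ : Fin n → Valuation L.toDataSig → Val L.toDataSig → Prop) (ρ : Valuation L.toDataSig)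
    (ys : Fin n → Val L.toDataSig) : Prop :=
  ∀ i, L.HasBase (ys i) (base i) ∧ φ i ρ (ys i)

/-! ### Typing rules -/

/-- `Γ ⊢ e :: ⟨τ; α⟩` for E-terms. In the types of applications, the variables `z_i` that stand for
the values of the arguments are bound by an existential quantifier. -/
inductive ETyping (Γ : Env L.toDataSig) : Term L.toDataSig → RType L.toDataSig → Ann → Prop
  | sub {e : Term L.toDataSig} {τ τ' : RType L.toDataSig} {α α' : Ann}
      (he : ETyping Γ e τ α) (hτ : τ.Sub L Γ τ') (hα : α.Sub L Γ α') : ETyping Γ e τ' α'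
  | var {x : Var} {τ : RType L.toDataSig} (hx : (x, τ) ∈ Γ.vars) :
      ETyping Γ (.var x) ⟨τ.base, fun ρ v => τ.ref ρ v ∧ v = ρ x⟩ ⟨[], .one⟩
  | int (k : ℤ) : ETyping Γ (.int k) ⟨.int, fun _ v => v = .int k⟩ ⟨[], .one⟩
  | bool (b : Bool) : ETyping Γ (.bool b) ⟨.bool, fun _ v => v = .bool b⟩ ⟨[], .one⟩
  /-- Application of a datatype constructor. -/
  | con {d : L.Data} (c : L.Ctor d) {args : Fin (L.arity c) → Term L.toDataSig}
      {φ : Fin (L.arity c) → Valuation L.toDataSig → Val L.toDataSig → Prop}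
      {α : Ann} {αs : Fin (L.arity c) → Ann} (hα : α.Shares αs)
      (hargs : ∀ i, ETyping Γ (args i) ⟨L.argBase c i, φ i⟩ (αs i))
      (hsub : ∀ ρ, Γ.Inst L ρ → ∀ ys, ArgsOf L (L.argBase c) φ ρ ys → ∀ i, L.argRef c i ys) :
      ETyping Γ (.con c args)
        ⟨.data d, fun ρ v => ∃ zs, v = .con c zs ∧ ArgsOf L (L.argBase c) φ ρ zs⟩ α
  /-- Application of an auxiliary function. -/
  | app {g : Var} {n : ℕ} {G₀ G : FnType L.toDataSig n} (hg : g ≠ Γ.recFun)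
      (hG₀ : Γ.aux g = some ⟨n, G₀⟩) (hG : G₀.Sub L Γ G)
      {args : Fin n → Term L.toDataSig}
      {φ : Fin n → Valuation L.toDataSig → Val L.toDataSig → Prop}
      {α : Ann} {αs : Fin n → Ann} (hα : α.Shares αs)
      (hargs : ∀ i, ETyping Γ (args i) ⟨G.argBase i, φ i⟩ (αs i))
      (hsub : ∀ ρ, Γ.Inst L ρ → ∀ ys, ArgsOf L G.argBase φ ρ ys → ∀ i, G.argRef i ys)
      (hbound : ∃ (c : ℕ) (M : ℝ), 0 ≤ M ∧ ∀ ρ, Γ.Inst L ρ → ∀ ys, ArgsOf L G.argBase φ ρ ys →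
        c ≤ Γ.size ρ → G.bound.eval (G.size ys) ≤ M * α.bound.eval (Γ.size ρ)) :
      ETyping Γ (.app (.var g) args)
        ⟨G.resBase, fun ρ v => ∃ zs, G.resRef zs v ∧ ArgsOf L G.argBase φ ρ zs⟩ α
  /-- Recursive call, charged to the recursive-call cost `[c, ϕ]`. -/
  | recApp {G : FnType L.toDataSig Γ.recArity} (hG : Γ.recTy.Sub L Γ G)
      {args : Fin Γ.recArity → Term L.toDataSig}
      {φ : Fin Γ.recArity → Valuation L.toDataSig → Val L.toDataSig → Prop}
      {cs₁ cs₂ : List (ℕ × SizeExpr)} {c : ℕ} {ϕ : SizeExpr} {ψ : BoundExpr}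
      {αs : Fin Γ.recArity → Ann} (hα : Ann.Shares ⟨cs₁ ++ (c, ϕ) :: cs₂, ψ⟩ αs)
      (hargs : ∀ i, ETyping Γ (args i) ⟨G.argBase i, φ i⟩ (αs i))
      (hsub : ∀ ρ, Γ.Inst L ρ → ∀ ys, ArgsOf L G.argBase φ ρ ys → ∀ i, G.argRef i ys)
      (hsize : ∀ ρ, Γ.Inst L ρ → ∀ ys, ArgsOf L G.argBase φ ρ ys →
        (G.size ys : ℤ) ≤ ϕ (Γ.size ρ)) :
      ETyping Γ (.app (.var Γ.recFun) args)
        ⟨G.resBase, fun ρ v => ∃ zs, G.resRef zs v ∧ ArgsOf L G.argBase φ ρ zs⟩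
        ⟨cs₁ ++ (c + 1, ϕ) :: cs₂, ψ⟩

/-- `Γ ⊢ t :: ⟨τ; α⟩` for terms of a non-arrow type: E-terms and branching terms. -/
inductive Typing : Env L.toDataSig → Term L.toDataSig → RType L.toDataSig → Ann → Prop
  | elim {Γ : Env L.toDataSig} {e : Term L.toDataSig} {τ : RType L.toDataSig} {α : Ann}
      (he : ETyping L Γ e τ α) : Typing Γ e τ α
  /-- The path conditions are `[true/v]φ` and `[false/v]φ`, where `{Bool | φ}` is the type of the
  guard; they are `φ'` and `¬φ'` if `φ` is `v ↔ φ'`. -/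
  | ite {Γ : Env L.toDataSig} {e t₁ t₂ : Term L.toDataSig} {τ : RType L.toDataSig}
      {φ : Valuation L.toDataSig → Val L.toDataSig → Prop} {α α₁ α₂ : Ann}
      (hα : α.Shares ![α₁, α₂]) (he : ETyping L Γ e ⟨.bool, φ⟩ α₁)
      (h₁ : Typing (Γ.assume fun ρ => φ ρ (.bool true)) t₁ τ α₂)
      (h₂ : Typing (Γ.assume fun ρ => φ ρ (.bool false)) t₂ τ α₂) :
      Typing Γ (.ite e t₁ t₂) τ α
  /-- In the branch of `C`, binding `ys`, the path condition is `[C(ys)/v]φ`, where `{D | φ}` is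
  the type of the scrutinee. The variables `ys` are distinct new names. -/
  | mtch {Γ : Env L.toDataSig} {d : L.Data} {e : Term L.toDataSig}
      {ys : (c : L.Ctor d) → Fin (L.arity c) → Var} {br : L.Ctor d → Term L.toDataSig}
      {τ : RType L.toDataSig} {φ : Valuation L.toDataSig → Val L.toDataSig → Prop} {α α₁ α₂ : Ann}
      (hα : α.Shares ![α₁, α₂]) (he : ETyping L Γ e ⟨.data d, φ⟩ α₁)
      (hinj : ∀ c, Function.Injective (ys c)) (hfresh : ∀ c j, ys c j ∉ Γ.dom)
      (hbr : ∀ c, Typing ((Γ.bind (bindings (ys c) (L.argBase c) (L.argRef c))).assume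
        fun ρ => φ ρ (.con c fun j => ρ (ys c j))) (br c) τ α₂) :
      Typing Γ (.mtch d e ys br) τ α

end Typing

/-- The environment in which the body of `fix f. λ xs. t` is checked against the type `F`, given
the signatures `aux` of the auxiliary functions. -/
def bodyEnv {S : DataSig} (aux : Var → Option (Σ n, FnType S n)) (f : Var) {n : ℕ}
    (F : FnType S n) (xs : Fin n → Var) : Env S where
  aux := aux
  recFun := f
  recArity := n
  recTy := F
  args := xs
  vars := bindings xs F.argBase F.argRef
  path := []

/-- The type `{B | φ}` of the body, where `F` is the type `x_1 : τ_1 → … → x_n : τ_n → {B | φ}`. -/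
def bodyType {S : DataSig} {n : ℕ} (F : FnType S n) (xs : Fin n → Var) : RType S :=
  ⟨F.resBase, fun ρ v => F.resRef (fun i => ρ (xs i)) v⟩

/-- The substitution of implementations for the auxiliary functions. -/
def auxSubst {S : DataSig} (aux : Var → Option (Σ n, FnType S n)) (impl : Var → Term S) :
    Subst S :=
  fun g => if (aux g).isSome then some (impl g) else none

/-! ### Recurrence relations -/

/-- The extension of `T` by `0` to negative arguments: there are no problems of negative size. -/
def extendZero (T : ℕ → ℕ) : ℤ → ℕ
  | Int.ofNat k => T k
  | Int.negSucc _ => 0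

/-- `T` satisfies the recurrence relation `T(u) ≤ c_1 T(φ_1) + … + c_m T(φ_m) + O(ψ)` given by the
annotation `([c_1, φ_1], …, [c_m, φ_m]; O(ψ))`. -/
def SatisfiesRecurrence (T : ℕ → ℕ) (α : Ann) : Prop :=
  ∃ h : ℕ → ℕ, IsBigO (fun u => (h u : ℝ)) α.bound.eval ∧
    ∀ u, T u ≤ (α.calls.map fun p => p.1 * extendZero T (p.2 u)).sum + h u

end SynPlexity

/-!
The resource usage of a call `f(zs)` of size `u` is that of evaluating the body `t` with the values
`zs` for the parameters. By induction on the typing derivation of `t` there are constants `c` and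
`M`, depending on the derivation but not on `zs`, such that for `u ≥ c` this usage is at most
`∑ c_i T(φ_i(u)) + M ψ(u)` (`ETyping.sound`, `Typing.sound`). A reduction of an application is split
into the reductions of its arguments and that of the call itself (`Runs.app_inv`). The arguments are
paid for by the parts of the annotation that they share (`Ann.Shares.sum_callCost_le`). The call is
paid for as follows.

* A recursive call has arguments of size at most `φ_k(u)`, so it uses at most `T(φ_k(u))` units,
  since `T` is monotone and bounds the usage of all calls of `f`. This is the unit by which the
  rule for recursive calls increases `c_k`.
* A call of an auxiliary function on arguments of size `s` uses at most `M' ψ_g(s) + K` units, where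
  the constant `K` covers the small `s` (`FnType.Implements.exists_cost_le`). The rule bounds
  `ψ_g(s)` by a multiple of `ψ(u)`, and `K` is at most `K ψ(u)`, since `1 ≤ ψ(u)` for `u ≥ 3`.

These estimates need to know that the values of terms satisfy their refinements, which is proved in
the same induction. For the results of recursive calls this is circular, and the circle is broken by
counting reduction steps: the calls made by the body belong to a strictly shorter reduction than the
call being evaluated (`recSound_bodyEnv`).

Two points concern the encoding. Reductions substitute values in stages (first the implementations
of the auxiliary functions, then the arguments, then the variables bound by each `match`), and
`Term.subst_subst` merges the stages into one closed substitution. Moreover, the predicates in types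
and path conditions may mention names that are not bound yet and that are bound later by a `match`;
hence the induction over branching terms is about valuations all of whose modifications outside of
the bound names are instances of the environment (`Env.StableInst`).
-/

namespace SynPlexity

/-! ### Counted reductions -/

section Runs

variable {S : DataSig}

theorem Val.toTerm_injective : Function.Injective (Val.toTerm (S := S)) := by
  intro v
  induction v with
  | bool b => intro w h; cases w <;> simp_all [Val.toTerm]
  | int k => intro w h; cases w <;> simp_all [Val.toTerm]
  | con c zs ih =>
    intro w h
    cases w with
    | bool b => simp [Val.toTerm] at h
    | int k => simp [Val.toTerm] at h
    | con c' zs' =>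
      simp only [Val.toTerm, Term.con.injEq] at h
      obtain ⟨rfl, h⟩ := h
      obtain ⟨h1, h2⟩ := h
      cases h1
      simp only [heq_eq_eq] at h2
      congr 1
      funext j
      exact ih j (congrFun h2 j)

theorem Val.not_step (v : Val S) {C : ℕ} {r : Term S × ℕ} : ¬ Step (v.toTerm, C) r := by
  induction v generalizing C r with
  | bool b => intro h; cases h
  | int k => intro h; cases h
  | con c zs ih =>
    intro h
    cases h with
    | conArg _ _ i _ t' _ Δ h => exact ih i h

/-- The cost component of a configuration is only accumulated, never inspected. -/
theorem Step.shift {t t' : Term S} {C C' : ℕ} (h : Step (t, C) (t', C')) :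
    ∃ Δ, C' = C + Δ ∧ ∀ D, Step (t, D) (t', D + Δ) := by
  cases h with
  | tick c t => exact ⟨c, rfl, fun D => .tick ..⟩
  | app f xs t vs => exact ⟨0, rfl, fun D => .app ..⟩
  | appArg f xs t args i hv t' _ Δ h => exact ⟨Δ, rfl, fun D => .appArg _ _ _ _ _ hv _ _ _ h⟩
  | conArg c args i hv t' _ Δ h => exact ⟨Δ, rfl, fun D => .conArg _ _ _ hv _ _ _ h⟩
  | iteTrue => exact ⟨0, rfl, fun D => .iteTrue ..⟩
  | iteFalse => exact ⟨0, rfl, fun D => .iteFalse ..⟩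
  | iteGuard e e' t₁ t₂ _ Δ h => exact ⟨Δ, rfl, fun D => .iteGuard _ _ _ _ _ _ h⟩
  | mtch c zs ys br => exact ⟨0, rfl, fun D => .mtch ..⟩
  | mtchScrutinee d e e' ys br _ Δ h => exact ⟨Δ, rfl, fun D => .mtchScrutinee _ _ _ _ _ _ _ h⟩
  | op o a b => exact ⟨0, rfl, fun D => .op ..⟩
  | opLeft o t₁ t₁' t₂ _ Δ h => exact ⟨Δ, rfl, fun D => .opLeft _ _ _ _ _ _ h⟩
  | opRight o a t₂ t₂' _ Δ h => exact ⟨Δ, rfl, fun D => .opRight _ _ _ _ _ _ h⟩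

/-- `Runs k t v C`: the term `t` reduces to the value `v` in `k` steps, with resource usage `C`. -/
inductive Runs : ℕ → Term S → Val S → ℕ → Prop
  | done {t : Term S} {v : Val S} (h : t = v.toTerm) : Runs 0 t v 0
  | step {k : ℕ} {t t' : Term S} {v : Val S} {Δ C : ℕ} (h : Step (t, 0) (t', Δ))
      (hr : Runs k t' v C) : Runs (k + 1) t v (Δ + C)

theorem Term.evals_iff_exists_runs {t : Term S} {v : Val S} {C : ℕ} :
    t.Evals v C ↔ ∃ k, Runs k t v C := by
  constructor
  · have key : ∀ a : Term S × ℕ, Relation.ReflTransGen Step a (v.toTerm, C) →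
        ∃ k E, C = a.2 + E ∧ Runs k a.1 v E := by
      intro a ha
      induction ha using Relation.ReflTransGen.head_induction_on with
      | refl => exact ⟨0, 0, rfl, .done rfl⟩
      | head hs _ ih =>
        obtain ⟨k, E, hC, hr⟩ := ih
        obtain ⟨Δ, hΔ, hst⟩ := Step.shift hs
        refine ⟨k + 1, Δ + E, by omega, .step ?_ hr⟩
        simpa using hst 0
    intro h
    obtain ⟨k, E, hC, hr⟩ := key _ h
    obtain rfl : C = E := by simpa using hC
    exact ⟨k, hr⟩
  · rintro ⟨k, h⟩
    have key : ∀ D, Relation.ReflTransGen Step (t, D) (v.toTerm, D + C) := by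
      induction h with
      | done h => intro D; rw [h]; exact .refl
      | step hs _ ih =>
        intro D
        obtain ⟨Δ', hΔ, hst⟩ := Step.shift hs
        obtain rfl : _ = Δ' := by simpa using hΔ
        rw [← Nat.add_assoc]
        exact .head (hst D) (ih _)
    simpa [Term.Evals] using key 0

theorem Runs.of_toTerm {k : ℕ} {v w : Val S} {C : ℕ} (h : Runs k v.toTerm w C) :
    w = v ∧ C = 0 := by
  cases h with
  | done h => exact ⟨(Val.toTerm_injective h).symm, rfl⟩
  | step h => exact (v.not_step h).elim

/-- The arguments `args` reduce to the values `vs`, each of them in at most `k` steps, with total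
resource usage `C`. -/
def ArgRuns (k : ℕ) {n : ℕ} (args : Fin n → Term S) (vs : Fin n → Val S) (C : ℕ) : Prop :=
  ∃ ks Cs : Fin n → ℕ, (∀ i, ks i ≤ k ∧ Runs (ks i) (args i) (vs i) (Cs i)) ∧ C = ∑ i, Cs i

theorem ArgRuns.toTerm (k : ℕ) {n : ℕ} (vs : Fin n → Val S) :
    ArgRuns k (fun i => (vs i).toTerm) vs 0 :=
  ⟨0, 0, fun _ => ⟨Nat.zero_le _, .done rfl⟩, by simp⟩

theorem ArgRuns.head {k n : ℕ} {args : Fin n → Term S} {vs : Fin n → Val S} {C Δ : ℕ} {i : Fin n}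
    {t' : Term S} (h : Step (args i, 0) (t', Δ)) (H : ArgRuns k (Function.update args i t') vs C) :
    ArgRuns (k + 1) args vs (Δ + C) := by
  obtain ⟨ks, Cs, hr, rfl⟩ := H
  refine ⟨fun j => ks j + if j = i then 1 else 0, fun j => (if j = i then Δ else 0) + Cs j,
    fun j => ?_, by simp [Finset.sum_add_distrib]⟩
  have hj := hr j
  by_cases hji : j = i
  · subst hji
    simp only [Function.update_self, if_true] at hj ⊢
    exact ⟨by omega, .step h hj.2⟩
  · simp only [Function.update_of_ne hji, if_neg hji, Nat.add_zero, Nat.zero_add] at hj ⊢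
    exact ⟨by omega, hj.2⟩

/-- A reduction of a function application first reduces all arguments to values. -/
theorem Runs.app_inv {k : ℕ} {f : Var} {n m : ℕ} {xs : Fin n → Var} {t : Term S}
    {args : Fin m → Term S} {v : Val S} {C : ℕ} (h : Runs k (.app (.fix f xs t) args) v C) :
    ∃ vs k' C₁ C₂, ArgRuns k args vs C₁ ∧ k' ≤ k ∧
      Runs k' (.app (.fix f xs t) fun i => (vs i).toTerm) v C₂ ∧ C = C₁ + C₂ := by
  induction k generalizing args C with
  | zero => cases h with
    | done h => cases v <;> simp [Val.toTerm] at h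
  | succ k ih => cases h with
    | step hs hr =>
      cases hs with
      | app _ _ _ vs =>
        exact ⟨vs, k + 1, 0, _, .toTerm _ vs, le_rfl, .step (.app ..) hr, (Nat.zero_add _).symm⟩
      | appArg _ _ _ _ i hv t' _ Δ hst =>
        obtain ⟨vs, k', C₁, C₂, hA, hk, hR, rfl⟩ := ih hr
        exact ⟨vs, k', _, C₂, hA.head hst, by omega, hR, by omega⟩

theorem Runs.con_inv {k : ℕ} {d : S.Data} {c : S.Ctor d} {args : Fin (S.arity c) → Term S}
    {v : Val S} {C : ℕ} (h : Runs k (.con c args) v C) :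
    ∃ vs, v = .con c vs ∧ ArgRuns k args vs C := by
  induction k generalizing args C with
  | zero => cases h with
    | done h =>
      cases v with
      | bool b => simp [Val.toTerm] at h
      | int k => simp [Val.toTerm] at h
      | con c' zs =>
        simp only [Val.toTerm] at h
        cases h
        exact ⟨zs, rfl, .toTerm 0 zs⟩
  | succ k ih => cases h with
    | step hs hr =>
      cases hs with
      | conArg _ _ i hv t' _ Δ hst =>
        obtain ⟨vs, rfl, hA⟩ := ih hr
        exact ⟨vs, rfl, by simpa using hA.head hst⟩

theorem Runs.ite_inv {k : ℕ} {e t₁ t₂ : Term S} {v : Val S} {C : ℕ}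
    (h : Runs k (.ite e t₁ t₂) v C) :
    ∃ b k₁ k₂ C₁ C₂, k₁ ≤ k ∧ k₂ ≤ k ∧ Runs k₁ e (.bool b) C₁ ∧
      Runs k₂ (if b then t₁ else t₂) v C₂ ∧ C = C₁ + C₂ := by
  induction k generalizing e C with
  | zero => cases h with
    | done h => cases v <;> simp [Val.toTerm] at h
  | succ k ih => cases h with
    | step hs hr =>
      cases hs with
      | iteTrue => exact ⟨true, 0, k, 0, _, by omega, by omega, .done rfl, hr, rfl⟩
      | iteFalse => exact ⟨false, 0, k, 0, _, by omega, by omega, .done rfl, hr, rfl⟩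
      | iteGuard _ e' _ _ _ Δ hst =>
        obtain ⟨b, k₁, k₂, C₁, C₂, h1, h2, hR, hR', rfl⟩ := ih hr
        exact ⟨b, k₁ + 1, k₂, _, C₂, by omega, by omega, .step hst hR, hR', by omega⟩

theorem Runs.mtch_inv {k : ℕ} {d : S.Data} {e : Term S}
    {ys : (c : S.Ctor d) → Fin (S.arity c) → Var} {br : S.Ctor d → Term S} {v : Val S} {C : ℕ}
    (h : Runs k (.mtch d e ys br) v C) :
    ∃ c zs k₁ k₂ C₁ C₂, k₁ ≤ k ∧ k₂ ≤ k ∧ Runs k₁ e (.con c zs) C₁ ∧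
      Runs k₂ ((br c).subst (.ofVals (ys c) zs)) v C₂ ∧ C = C₁ + C₂ := by
  induction k generalizing e C with
  | zero => cases h with
    | done h => cases v <;> simp [Val.toTerm] at h
  | succ k ih => cases h with
    | step hs hr =>
      cases hs with
      | mtch c zs => exact ⟨c, zs, 0, k, 0, _, by omega, by omega, .done rfl, hr, rfl⟩
      | mtchScrutinee _ _ e' _ _ _ Δ hst =>
        obtain ⟨c, zs, k₁, k₂, C₁, C₂, h1, h2, hR, hR', rfl⟩ := ih hr
        exact ⟨c, zs, k₁ + 1, k₂, _, C₂, by omega, by omega, .step hst hR, hR', by omega⟩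

/-- A call on values starts by substituting them in the body: their own terms do not reduce. -/
theorem Runs.unfold {k : ℕ} {f : Var} {n : ℕ} {xs : Fin n → Var} {t : Term S}
    {zs : Fin n → Val S} {v : Val S} {C : ℕ}
    (h : Runs k (.app (.fix f xs t) fun i => (zs i).toTerm) v C) :
    ∃ k' < k, Runs k' (t.subst (.unfold f xs t zs)) v C := by
  generalize hargs : (fun i => (zs i).toTerm) = args at h
  cases h with
  | done h => cases v <;> simp [Val.toTerm] at h
  | step hs hr =>
    cases hs with
    | app _ _ _ vs =>
      obtain rfl : zs = vs := funext fun i => Val.toTerm_injective (congrFun hargs i)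
      exact ⟨_, Nat.lt_succ_self _, by simpa using hr⟩
    | appArg _ _ _ _ i _ t' _ Δ hst =>
      subst hargs
      exact ((zs i).not_step hst).elim

end Runs

/-! ### Free variables and composition of substitutions -/

section Substitution

variable {S : DataSig}

theorem Val.fv_toTerm (v : Val S) : v.toTerm.fv = ∅ := by
  induction v with
  | bool b => rfl
  | int k => rfl
  | con c zs ih => simp [Val.toTerm, Term.fv, ih]

theorem Subst.ofVals_apply {n : ℕ} {xs : Fin n → Var} (hxs : Function.Injective xs)
    (vs : Fin n → Val S) (i : Fin n) : Subst.ofVals xs vs (xs i) = some (vs i).toTerm := by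
  have h : ∃ j, xs j = xs i := ⟨i, rfl⟩
  rw [Subst.ofVals, dif_pos h, hxs h.choose_spec]

theorem Subst.ofVals_of_notMem {n : ℕ} {xs : Fin n → Var} (vs : Fin n → Val S) {y : Var}
    (hy : ∀ i, xs i ≠ y) : Subst.ofVals xs vs y = none := by
  rw [Subst.ofVals, dif_neg (by simpa using hy)]

/-- The terms substituted by `σ` are closed. -/
def Subst.Closed (σ : Subst S) : Prop := ∀ y s, σ y = some s → s.fv = ∅

theorem Subst.Closed.without {σ : Subst S} (h : σ.Closed) (X : Set Var) : (σ.without X).Closed := by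
  intro y s hy
  unfold Subst.without at hy
  split_ifs at hy
  exact h y s hy

theorem Subst.closed_ofVals {n : ℕ} (xs : Fin n → Var) (vs : Fin n → Val S) :
    (Subst.ofVals xs vs).Closed := by
  intro y s hy
  unfold Subst.ofVals at hy
  split_ifs at hy
  obtain rfl := Option.some.inj hy
  exact Val.fv_toTerm _

theorem Term.subst_eq_self {t : Term S} {σ : Subst S} (h : ∀ y ∈ t.fv, σ y = none) :
    t.subst σ = t := by
  induction t generalizing σ with
  | var x => simp [Term.subst, h x (by simp [Term.fv])]
  | int => rfl
  | bool => rfl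
  | con c args ih =>
    simp only [Term.subst]
    congr 1
    funext j
    exact ih j fun y hy => h y (by simp only [Term.fv, Set.mem_iUnion]; exact ⟨j, hy⟩)
  | app g args ihg ih =>
    simp only [Term.fv, Set.mem_union, Set.mem_iUnion] at h
    simp only [Term.subst]
    rw [ihg fun y hy => h y (.inl hy)]
    congr 1
    funext j
    exact ih j fun y hy => h y (.inr ⟨j, hy⟩)
  | ite e t₁ t₂ ihe ih₁ ih₂ =>
    simp only [Term.fv, Set.mem_union] at h
    simp only [Term.subst]
    rw [ihe fun y hy => h y (.inl (.inl hy)), ih₁ fun y hy => h y (.inl (.inr hy)),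
      ih₂ fun y hy => h y (.inr hy)]
  | mtch d e ys br ihe ih =>
    simp only [Term.fv, Set.mem_union, Set.mem_iUnion] at h
    simp only [Term.subst]
    rw [ihe fun y hy => h y (.inl hy)]
    congr 1
    funext c
    refine ih c fun y hy => ?_
    unfold Subst.without
    split_ifs with hys
    · rfl
    · exact h y (.inr ⟨c, hy, hys⟩)
  | fix f xs t ih =>
    simp only [Term.fv] at h
    simp only [Term.subst]
    congr 1
    refine ih fun y hy => ?_
    unfold Subst.without
    split_ifs with hys
    · rfl
    · exact h y ⟨hy, hys⟩
  | tick c t ih =>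
    simp only [Term.subst]
    rw [ih h]
  | op o t₁ t₂ ih₁ ih₂ =>
    simp only [Term.fv, Set.mem_union] at h
    simp only [Term.subst]
    rw [ih₁ fun y hy => h y (.inl hy), ih₂ fun y hy => h y (.inr hy)]

/-- `σ` where it is defined, and `τ` elsewhere. For closed `σ`, this is `σ` followed by `τ`. -/
def Subst.comp (σ τ : Subst S) : Subst S := fun y => (σ y).orElse fun _ => τ y

theorem Subst.comp_of_some {σ τ : Subst S} {y : Var} {s : Term S} (h : σ y = some s) :
    σ.comp τ y = some s := by
  simp [Subst.comp, h]

theorem Subst.comp_of_none {σ τ : Subst S} {y : Var} (h : σ y = none) : σ.comp τ y = τ y := by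
  simp [Subst.comp, h]

theorem Subst.Closed.comp {σ τ : Subst S} (hσ : σ.Closed) (hτ : τ.Closed) : (σ.comp τ).Closed := by
  intro y s hy
  cases h : σ y with
  | none => exact hτ y s (by rwa [Subst.comp_of_none h] at hy)
  | some s' => exact hσ y s (by rwa [Subst.comp_of_some h, ← h] at hy)

theorem Subst.without_comp (σ τ : Subst S) (X : Set Var) :
    (σ.comp τ).without X = (σ.without X).comp (τ.without X) := by
  funext y
  by_cases hy : y ∈ X <;> simp [Subst.comp, Subst.without, hy]

/-- The terms substituted by `σ` must be closed, as those substituted by `τ` would otherwise have to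
be inserted into them; `τ` itself is arbitrary. -/
theorem Term.subst_subst (t : Term S) {σ : Subst S} (hσ : σ.Closed) (τ : Subst S) :
    (t.subst σ).subst τ = t.subst (σ.comp τ) := by
  induction t generalizing σ τ with
  | var x =>
    cases h : σ x with
    | none => simp [Term.subst, h, Subst.comp]
    | some s =>
      have : s.subst τ = s := Term.subst_eq_self (by simp [hσ x s h])
      simpa [Term.subst, h, Subst.comp] using this
  | int => rfl
  | bool => rfl
  | con c args ih => simp [Term.subst, ih _ hσ]
  | app g args ihg ih => simp [Term.subst, ihg hσ, ih _ hσ]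
  | ite e t₁ t₂ ihe ih₁ ih₂ => simp [Term.subst, ihe hσ, ih₁ hσ, ih₂ hσ]
  | mtch d e ys br ihe ih =>
    simp [Term.subst, ihe hσ, fun c => ih c (hσ.without (Set.range (ys c))), Subst.without_comp]
  | fix f xs t ih => simp [Term.subst, ih (hσ.without _), Subst.without_comp]
  | tick c t ih => simp [Term.subst, ih hσ]
  | op o t₁ t₂ ih₁ ih₂ => simp [Term.subst, ih₁ hσ, ih₂ hσ]

theorem Term.fv_subst_subset (t : Term S) {σ : Subst S} (hσ : σ.Closed) :
    (t.subst σ).fv ⊆ {y ∈ t.fv | σ y = none} := by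
  have key : ∀ {σ : Subst S} {X : Set Var} {y : Var},
      y ∉ X → σ.without X y = none → σ y = none := by
    intro σ X y hy h
    simpa [Subst.without, hy] using h
  induction t generalizing σ with
  | var x =>
    intro y hy
    cases h : σ x with
    | none =>
      simp only [Term.subst, h, Option.getD_none, Term.fv, Set.mem_singleton_iff] at hy
      subst hy
      exact ⟨rfl, h⟩
    | some s => simp [Term.subst, h, hσ x s h] at hy
  | int => simp [Term.subst, Term.fv]
  | bool => simp [Term.subst, Term.fv]
  | con c args ih =>
    intro y hy
    simp only [Term.subst, Term.fv, Set.mem_iUnion] at hy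
    obtain ⟨j, hj⟩ := hy
    have := ih j hσ hj
    exact ⟨by simp only [Term.fv, Set.mem_iUnion]; exact ⟨j, this.1⟩, this.2⟩
  | app g args ihg ih =>
    intro y hy
    simp only [Term.subst, Term.fv, Set.mem_union, Set.mem_iUnion] at hy
    simp only [Term.fv, Set.mem_ofPred_eq, Set.mem_union, Set.mem_iUnion]
    rcases hy with h | ⟨j, h⟩
    · exact ⟨.inl (ihg hσ h).1, (ihg hσ h).2⟩
    · exact ⟨.inr ⟨j, (ih j hσ h).1⟩, (ih j hσ h).2⟩
  | ite e t₁ t₂ ihe ih₁ ih₂ =>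
    intro y hy
    simp only [Term.subst, Term.fv, Set.mem_union] at hy
    simp only [Term.fv, Set.mem_ofPred_eq, Set.mem_union]
    rcases hy with (h | h) | h
    · exact ⟨.inl (.inl (ihe hσ h).1), (ihe hσ h).2⟩
    · exact ⟨.inl (.inr (ih₁ hσ h).1), (ih₁ hσ h).2⟩
    · exact ⟨.inr (ih₂ hσ h).1, (ih₂ hσ h).2⟩
  | mtch d e ys br ihe ih =>
    intro y hy
    simp only [Term.subst, Term.fv, Set.mem_union, Set.mem_iUnion] at hy
    simp only [Term.fv, Set.mem_ofPred_eq, Set.mem_union, Set.mem_iUnion]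
    rcases hy with h | ⟨c, h, hn⟩
    · exact ⟨.inl (ihe hσ h).1, (ihe hσ h).2⟩
    · have := ih c (hσ.without (Set.range (ys c))) h
      exact ⟨.inr ⟨c, this.1, hn⟩, key hn this.2⟩
  | fix f xs t ih =>
    rintro y ⟨h, hn⟩
    have := ih (hσ.without _) h
    exact ⟨⟨this.1, hn⟩, key hn this.2⟩
  | tick c t ih => exact ih hσ
  | op o t₁ t₂ ih₁ ih₂ =>
    intro y hy
    simp only [Term.subst, Term.fv, Set.mem_union] at hy
    simp only [Term.fv, Set.mem_ofPred_eq, Set.mem_union]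
    rcases hy with h | h
    · exact ⟨.inl (ih₁ hσ h).1, (ih₁ hσ h).2⟩
    · exact ⟨.inr (ih₂ hσ h).1, (ih₂ hσ h).2⟩

theorem mem_map_fst_bindings {n : ℕ} {xs : Fin n → Var} {base : Fin n → Base S}
    {ref : Fin n → (Fin n → Val S) → Prop} {y : Var} :
    y ∈ (bindings xs base ref).map Prod.fst ↔ ∃ i, xs i = y := by
  simp [bindings, List.mem_ofFn]

theorem ETyping.fv_subset {L : DataDecl} {Γ : Env L.toDataSig} {e : Term L.toDataSig}
    {τ : RType L.toDataSig} {α : Ann} (h : ETyping L Γ e τ α) : e.fv ⊆ Γ.dom := by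
  induction h with
  | sub _ _ _ ih => exact ih
  | var hx =>
    rintro y rfl
    exact .inr (.inr (List.mem_map_of_mem hx))
  | int => simp [Term.fv]
  | bool => simp [Term.fv]
  | con c _ _ _ ih => simpa [Term.fv] using ih
  | app hg hG₀ _ _ _ _ _ ih =>
    simp only [Term.fv, Set.union_subset_iff, Set.iUnion_subset_iff, Set.singleton_subset_iff]
    exact ⟨.inr (.inl (by simp [hG₀])), ih⟩
  | recApp _ _ _ _ _ ih =>
    simp only [Term.fv, Set.union_subset_iff, Set.iUnion_subset_iff, Set.singleton_subset_iff]
    exact ⟨.inl rfl, ih⟩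

theorem Typing.fv_subset {L : DataDecl} {Γ : Env L.toDataSig} {e : Term L.toDataSig}
    {τ : RType L.toDataSig} {α : Ann} (h : Typing L Γ e τ α) : e.fv ⊆ Γ.dom := by
  induction h with
  | elim he => exact he.fv_subset
  | ite _ he _ _ ih₁ ih₂ =>
    simp only [Term.fv, Set.union_subset_iff]
    exact ⟨⟨he.fv_subset, ih₁⟩, ih₂⟩
  | mtch _ he _ _ _ ih =>
    simp only [Term.fv, Set.union_subset_iff, Set.iUnion_subset_iff]
    refine ⟨he.fv_subset, fun c y hy => ?_⟩
    rcases ih c hy.1 with h | h | h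
    · exact .inl h
    · exact .inr (.inl h)
    · simp only [Env.assume, Env.bind, List.map_append, List.mem_append,
        mem_map_fst_bindings] at h
      rcases h with h | h
      · exact (hy.2 h).elim
      · exact .inr (.inr h)

end Substitution

/-! ### Costs given by annotations -/

section Cost

theorem BoundExpr.eval_nonneg (ψ : BoundExpr) (u : ℕ) : 0 ≤ ψ.eval u := by
  have := Real.log_natCast_nonneg u
  unfold BoundExpr.eval
  positivity

/-- Bound expressions are eventually at least `1`, so that constants can be absorbed in them. -/
theorem BoundExpr.one_le_eval (ψ : BoundExpr) {u : ℕ} (hu : 3 ≤ u) : 1 ≤ ψ.eval u := by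
  have hu' : (3 : ℝ) ≤ u := by exact_mod_cast hu
  have hlog : 1 ≤ Real.log u := by
    rw [Real.le_log_iff_exp_le (by linarith)]
    exact Real.exp_one_lt_three.le.trans hu'
  have h1 : 1 ≤ (u : ℝ) ^ (ψ.a : ℝ) := Real.one_le_rpow (by linarith) ψ.a.2
  have h2 : 1 ≤ Real.log u ^ (ψ.b : ℝ) := Real.one_le_rpow hlog ψ.b.2
  have h3 : (0 : ℝ) ≤ ψ.c := ψ.c.2
  unfold BoundExpr.eval
  nlinarith

theorem extendZero_mono {T : ℕ → ℕ} (hT : Monotone T) : Monotone (extendZero T) := by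
  intro a b hab
  cases a with
  | negSucc a => exact Nat.zero_le _
  | ofNat a =>
    cases b with
    | negSucc b => exact absurd hab (by simp only [Int.ofNat_eq_natCast]; omega)
    | ofNat b => exact hT (by simpa using hab)

/-- The cost `c_1 T(φ_1(u)) + … + c_m T(φ_m(u))` of the recursive calls of an annotation. -/
def callCost (T : ℕ → ℕ) (cs : List (ℕ × SizeExpr)) (u : ℕ) : ℕ :=
  (cs.map fun p => p.1 * extendZero T (p.2 u)).sum

theorem callCost_cons (T : ℕ → ℕ) (p : ℕ × SizeExpr) (cs : List (ℕ × SizeExpr)) (u : ℕ) :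
    callCost T (p :: cs) u = p.1 * extendZero T (p.2 u) + callCost T cs u := by
  simp [callCost]

/-- Sums over positions make annotations with the same size expressions comparable. -/
theorem callCost_eq_sum (T : ℕ → ℕ) (cs : List (ℕ × SizeExpr)) (u : ℕ) :
    callCost T cs u = ∑ k ∈ Finset.range (cs.map Prod.snd).length,
      (cs.map Prod.fst).getD k 0 * extendZero T ((cs.map Prod.snd).getD k 0 u) := by
  induction cs with
  | nil => simp [callCost]
  | cons p cs ih =>
    rw [callCost_cons, ih, List.map_cons, List.length_cons, Finset.sum_range_succ']
    simp [add_comm]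

theorem Ann.Shares.sum_callCost_le {α : Ann} {m : ℕ} {αs : Fin m → Ann} (h : α.Shares αs)
    (T : ℕ → ℕ) (u : ℕ) : ∑ j, callCost T (αs j).calls u ≤ callCost T α.calls u := by
  simp only [callCost_eq_sum, (h.1 _).2]
  rw [Finset.sum_comm]
  refine Finset.sum_le_sum fun k _ => ?_
  rw [← Finset.sum_mul]
  exact Nat.mul_le_mul_right _ (h.2 k)

/-- The guard or scrutinee and the branch taken together use at most the cost that they share. -/
theorem Ann.Shares.cost_branch {α α₁ α₂ : Ann} (h : α.Shares ![α₁, α₂]) {T : ℕ → ℕ}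
    {u C₁ C₂ : ℕ} {M₁ M₂ : ℝ} (h₁ : (C₁ : ℝ) ≤ callCost T α₁.calls u + M₁ * α₁.bound.eval u)
    (h₂ : (C₂ : ℝ) ≤ callCost T α₂.calls u + M₂ * α₂.bound.eval u) :
    ((C₁ + C₂ : ℕ) : ℝ) ≤ callCost T α.calls u + (M₁ + M₂) * α.bound.eval u := by
  have hb₁ : α₁.bound = α.bound := (h.1 0).1
  have hb₂ : α₂.bound = α.bound := (h.1 1).1
  have hs := h.sum_callCost_le T u
  rw [Fin.sum_univ_two] at hs
  have hs' : (callCost T α₁.calls u : ℝ) + callCost T α₂.calls u ≤ callCost T α.calls u := by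
    exact_mod_cast hs
  rw [hb₁] at h₁
  rw [hb₂] at h₂
  push_cast
  linarith

/-- Subtyping of annotations weakens the cost estimate, at the sizes of instances of `Γ`. -/
theorem Ann.Sub.exists_bound {L : DataDecl} {Γ : Env L.toDataSig} {α α' : Ann}
    (h : α.Sub L Γ α') {T : ℕ → ℕ} (hT : Monotone T) :
    ∃ (c : ℕ) (M : ℝ), 0 ≤ M ∧ ∀ ρ, Γ.Inst L ρ → c ≤ Γ.size ρ →
      callCost T α.calls (Γ.size ρ) ≤ callCost T α'.calls (Γ.size ρ) ∧
        α.bound.eval (Γ.size ρ) ≤ M * α'.bound.eval (Γ.size ρ) := by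
  cases h with
  | mono hcs hψ =>
    obtain ⟨c, M, hM, hψ⟩ := hψ
    refine ⟨c, M, hM, fun ρ hρ hc => ⟨?_, hψ ρ hρ hc⟩⟩
    clear hψ
    induction hcs with
    | nil => exact le_rfl
    | cons hpq _ ih =>
      simp only [callCost_cons] at ih ⊢
      exact Nat.add_le_add (Nat.mul_le_mul hpq.1 (extendZero_mono hT (hpq.2 ρ hρ))) ih
  | split hφ =>
    refine ⟨0, 1, zero_le_one, fun ρ hρ _ => ⟨le_of_eq ?_, by simp⟩⟩
    simp only [callCost_cons, hφ ρ hρ]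
    ring
  | combine hφ =>
    refine ⟨0, 1, zero_le_one, fun ρ hρ _ => ⟨le_of_eq ?_, by simp⟩⟩
    simp only [callCost_cons, hφ ρ hρ]
    ring
  | weaken =>
    refine ⟨0, 1, zero_le_one, fun ρ hρ _ => ⟨?_, by simp⟩⟩
    simp only [callCost_cons]
    omega
  | perm hp =>
    exact ⟨0, 1, zero_le_one, fun ρ hρ _ => ⟨(hp.map _).sum_eq.le, by simp⟩⟩

/-- The complexity of an auxiliary function in terms of the bound of a supertype of its signature;
the constant `K` accounts for small inputs. -/
theorem FnType.Implements.exists_cost_le {L : DataDecl} {n : ℕ}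
    {G₀ G : FnType L.toDataSig n} {p : Term L.toDataSig} (hp : G₀.Implements L p)
    (hG : IsBigO G₀.bound.eval G.bound.eval) :
    ∃ M K : ℝ, 0 ≤ M ∧ 0 ≤ K ∧ ∀ zs, G₀.IsInput L zs → ∀ v C,
      (Term.app p fun i => (zs i).toTerm).Evals v C →
        (C : ℝ) ≤ M * G.bound.eval (G₀.size zs) + K := by
  obtain ⟨-, -, -, T, hT, c₁, M₁, hM₁, h₁⟩ := hp
  obtain ⟨c₂, M₂, hM₂, h₂⟩ := hG
  refine ⟨M₁ * M₂, ∑ s ∈ Finset.range (c₁ + c₂), (T s : ℝ), by positivity, by positivity,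
    fun zs hzs v C hC => ?_⟩
  have hCT : (C : ℝ) ≤ T (G₀.size zs) := by
    exact_mod_cast (hT.2 (G₀.size zs)).1 ⟨zs, hzs, rfl, v, hC⟩
  have hK : (0 : ℝ) ≤ ∑ s ∈ Finset.range (c₁ + c₂), (T s : ℝ) := by positivity
  have hG0 := G.bound.eval_nonneg (G₀.size zs)
  rcases lt_or_ge (G₀.size zs) (c₁ + c₂) with hs | hs
  · have := Finset.single_le_sum (f := fun s => (T s : ℝ)) (fun s _ => Nat.cast_nonneg _)
      (Finset.mem_range.2 hs)
    have h0 : 0 ≤ M₁ * M₂ * G.bound.eval (G₀.size zs) := by positivity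
    linarith
  · have e₁ := h₁ (G₀.size zs) (by omega)
    have e₂ := mul_le_mul_of_nonneg_left (h₂ (G₀.size zs) (by omega)) hM₁
    linarith

end Cost

/-! ### Soundness of the typing rules for values and costs -/

section Soundness

variable {L : DataDecl}

/-- Every valuation that agrees with `ρ` on the bound variables is an instance of `Γ`. Refinements
and path conditions are arbitrary predicates of the whole valuation, so this is stronger than
`Γ.Inst L ρ`; unlike that, it is preserved when a name that is not yet bound gets a value. -/
def Env.StableInst (L : DataDecl) (Γ : Env L.toDataSig) (ρ : Valuation L.toDataSig) : Prop :=
  ∀ ρ', (∀ x ∈ Γ.vars.map Prod.fst, ρ' x = ρ x) → Γ.Inst L ρ'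

theorem Env.StableInst.inst {Γ : Env L.toDataSig} {ρ : Valuation L.toDataSig}
    (h : Γ.StableInst L ρ) : Γ.Inst L ρ := h ρ fun _ _ => rfl

/-- The closed substitution `σ` replaces the names of `Γ` by the values given by `ρ`, by the
implementations of the auxiliary functions, and by the recursive function `p`. -/
structure Env.Realizes (Γ : Env L.toDataSig) (impl : Var → Term L.toDataSig)
    (p : Term L.toDataSig) (ρ : Valuation L.toDataSig) (σ : Subst L.toDataSig) : Prop where
  vars : ∀ x ∈ Γ.vars.map Prod.fst, σ x = some (ρ x).toTerm
  aux : ∀ g, (Γ.aux g).isSome → σ g = some (impl g)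
  recFun : σ Γ.recFun = some p
  closed : σ.Closed

theorem Env.Realizes.congr {Γ : Env L.toDataSig} {impl : Var → Term L.toDataSig}
    {p : Term L.toDataSig} {ρ ρ' : Valuation L.toDataSig} {σ : Subst L.toDataSig}
    (h : Γ.Realizes impl p ρ σ) (hρ : ∀ x ∈ Γ.vars.map Prod.fst, ρ' x = ρ x) :
    Γ.Realizes impl p ρ' σ :=
  { h with vars := fun x hx => by rw [hρ x hx]; exact h.vars x hx }

/-- The functions of `Γ` are interpreted by the terms `impl g`, and by the term `p` with resource
usage at most `T`. -/
structure Env.Interpreted (Γ : Env L.toDataSig) (impl : Var → Term L.toDataSig)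
    (p : Term L.toDataSig) (T : ℕ → ℕ) : Prop where
  impl : ∀ g k (G : FnType L.toDataSig k), Γ.aux g = some ⟨k, G⟩ → G.Implements L (impl g)
  isFix : ∃ (f : Var) (xs : Fin Γ.recArity → Var) (t : Term L.toDataSig), p = .fix f xs t
  mono : Monotone T
  cost : ∀ zs, Γ.recTy.IsInput L zs → ∀ k v C,
    Runs k (.app p fun i => (zs i).toTerm) v C → C ≤ T (Γ.recTy.size zs)

/-- Calls of the recursive function that take at most `k` steps have results of its result type. -/
def Env.RecSound (Γ : Env L.toDataSig) (p : Term L.toDataSig) (k : ℕ) : Prop :=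
  ∀ j ≤ k, ∀ zs, Γ.recTy.IsInput L zs → ∀ v C, Runs j (.app p fun i => (zs i).toTerm) v C →
    L.HasBase v Γ.recTy.resBase ∧ Γ.recTy.resRef zs v

theorem Env.RecSound.anti {Γ : Env L.toDataSig} {p : Term L.toDataSig} {k k' : ℕ}
    (h : Γ.RecSound p k) (hk : k' ≤ k) : Γ.RecSound p k' :=
  fun j hj => h j (hj.trans hk)

/-- The meaning of a typing judgment, restricted to valuations in `R`: values of `e` have type `τ`,
and the resource usage of `e` at sizes `u ≥ c` is at most the cost of the recursive calls of `α`
plus `M` times the bound of `α`. The constants are uniform in the valuation. -/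
def Sound (Γ : Env L.toDataSig) (impl : Var → Term L.toDataSig) (p : Term L.toDataSig)
    (T : ℕ → ℕ) (R : Valuation L.toDataSig → Prop) (e : Term L.toDataSig)
    (τ : RType L.toDataSig) (α : Ann) (c : ℕ) (M : ℝ) : Prop :=
  ∀ ρ σ k v C, R ρ → Γ.Realizes impl p ρ σ → Γ.RecSound p k → Runs k (e.subst σ) v C →
    (L.HasBase v τ.base ∧ τ.ref ρ v) ∧ (c ≤ Γ.size ρ →
      (C : ℝ) ≤ callCost T α.calls (Γ.size ρ) + M * α.bound.eval (Γ.size ρ))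

variable {Γ : Env L.toDataSig} {impl : Var → Term L.toDataSig} {p : Term L.toDataSig} {T : ℕ → ℕ}

theorem Sound.mono {R : Valuation L.toDataSig → Prop} {e : Term L.toDataSig}
    {τ : RType L.toDataSig} {α : Ann} {c c' : ℕ} {M M' : ℝ} (h : Sound Γ impl p T R e τ α c M)
    (hc : c ≤ c') (hM : M ≤ M') : Sound Γ impl p T R e τ α c' M' := by
  intro ρ σ k v C hρ hσ hk hr
  obtain ⟨hv, hC⟩ := h ρ σ k v C hρ hσ hk hr
  refine ⟨hv, fun hu => (hC (hc.trans hu)).trans ?_⟩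
  gcongr
  exact α.bound.eval_nonneg _

/-- The arguments of an application use at most the cost that they share. -/
theorem ArgRuns.sound {R : Valuation L.toDataSig → Prop} {n : ℕ} {base : Fin n → Base L.toDataSig}
    {φ : Fin n → Valuation L.toDataSig → Val L.toDataSig → Prop} {args : Fin n → Term L.toDataSig}
    {α : Ann} {αs : Fin n → Ann} {cs : Fin n → ℕ} {Ms : Fin n → ℝ} (hα : α.Shares αs)
    (hs : ∀ i, Sound Γ impl p T R (args i) ⟨base i, φ i⟩ (αs i) (cs i) (Ms i))
    {ρ : Valuation L.toDataSig} {σ : Subst L.toDataSig} {k C : ℕ} {vs : Fin n → Val L.toDataSig}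
    (hρ : R ρ) (hσ : Γ.Realizes impl p ρ σ) (hk : Γ.RecSound p k)
    (hr : ArgRuns k (fun i => (args i).subst σ) vs C) :
    ArgsOf L base φ ρ vs ∧ (∑ i, cs i ≤ Γ.size ρ →
      (C : ℝ) ≤ callCost T α.calls (Γ.size ρ) + (∑ i, Ms i) * α.bound.eval (Γ.size ρ)) := by
  obtain ⟨ks, Cs, hr, rfl⟩ := hr
  have key := fun i => hs i ρ σ (ks i) (vs i) (Cs i) hρ hσ (hk.anti (hr i).1) (hr i).2
  refine ⟨fun i => (key i).1, fun hu => ?_⟩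
  have hshare : ((∑ i, callCost T (αs i).calls (Γ.size ρ) : ℕ) : ℝ) ≤
      callCost T α.calls (Γ.size ρ) := by exact_mod_cast hα.sum_callCost_le T _
  calc ((∑ i, Cs i : ℕ) : ℝ) = ∑ i, (Cs i : ℝ) := by push_cast; rfl
    _ ≤ ∑ i, ((callCost T (αs i).calls (Γ.size ρ) : ℝ) + Ms i * α.bound.eval (Γ.size ρ)) := by
        refine Finset.sum_le_sum fun i _ => ?_
        rw [← (hα.1 i).1]
        exact (key i).2 ((Finset.single_le_sum (fun _ _ => Nat.zero_le _)
          (Finset.mem_univ i)).trans hu)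
    _ ≤ _ := by
        rw [Finset.sum_add_distrib, ← Finset.sum_mul]
        push_cast at hshare
        linarith

/-- Soundness for terms without branching. The constants are computed along the derivation, before
any instance is chosen. -/
theorem ETyping.sound (hΓ : Γ.Interpreted impl p T) {e : Term L.toDataSig} {τ : RType L.toDataSig}
    {α : Ann} (h : ETyping L Γ e τ α) :
    ∃ (c : ℕ) (M : ℝ), 0 ≤ M ∧ Sound Γ impl p T (Γ.Inst L) e τ α c M := by
  induction h with
  | sub he hτ hα ih =>
    obtain ⟨c, M, hM, ih⟩ := ih
    obtain ⟨c', M', hM', hα⟩ := hα.exists_bound hΓ.mono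
    refine ⟨c + c', M * M', by positivity, fun ρ σ k v C hρ hσ hk hr => ?_⟩
    obtain ⟨⟨hv, hv'⟩, hC⟩ := ih ρ σ k v C hρ hσ hk hr
    refine ⟨⟨hτ.1 ▸ hv, hτ.2 ρ hρ v hv hv'⟩, fun hu => ?_⟩
    obtain ⟨h₁, h₂⟩ := hα ρ hρ (by omega)
    have h₁' := (Nat.cast_le (α := ℝ)).2 h₁
    have h₃ := mul_le_mul_of_nonneg_left h₂ hM
    have h₄ := hC (by omega)
    linarith
  | @var x τ hx =>
    refine ⟨0, 0, le_rfl, fun ρ σ k v C hρ hσ hk hr => ?_⟩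
    have hx' : σ x = some (ρ x).toTerm := hσ.vars x (List.mem_map_of_mem hx)
    simp only [Term.subst, hx', Option.getD_some] at hr
    obtain ⟨rfl, rfl⟩ := hr.of_toTerm
    have := hρ.1 _ hx
    exact ⟨⟨this.1, this.2, rfl⟩, fun _ => by simp [callCost]⟩
  | int z =>
    refine ⟨0, 0, le_rfl, fun ρ σ k v C hρ hσ hk hr => ?_⟩
    obtain ⟨rfl, rfl⟩ := Runs.of_toTerm (v := .int z) hr
    exact ⟨⟨by simp [DataDecl.HasBase], rfl⟩, fun _ => by simp [callCost]⟩
  | bool b =>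
    refine ⟨0, 0, le_rfl, fun ρ σ k v C hρ hσ hk hr => ?_⟩
    obtain ⟨rfl, rfl⟩ := Runs.of_toTerm (v := .bool b) hr
    exact ⟨⟨by simp [DataDecl.HasBase], rfl⟩, fun _ => by simp [callCost]⟩
  | con c hα hargs hsub ih =>
    choose cs Ms hMs ih using ih
    refine ⟨∑ i, cs i, ∑ i, Ms i, Finset.sum_nonneg fun i _ => hMs i,
      fun ρ σ k v C hρ hσ hk hr => ?_⟩
    obtain ⟨vs, rfl, hA⟩ := Runs.con_inv hr
    obtain ⟨hvs, hC⟩ := hA.sound hα ih hρ hσ hk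
    refine ⟨⟨?_, vs, rfl, hvs⟩, hC⟩
    simp only [DataDecl.HasBase, true_and]
    exact ⟨fun j => (hvs j).1, hsub ρ hρ vs hvs⟩
  | @app g n G₀ G hg hG₀ hG args φ α αs hα hargs hsub hbound ih =>
    choose cs Ms hMs ih using ih
    have hI := hΓ.impl g n G₀ hG₀
    obtain ⟨hargBase, hresBase, hsize, hO, hG⟩ := hG
    obtain ⟨M₁, K, hM₁, hK, hcost⟩ := hI.exists_cost_le hO
    obtain ⟨c₂, M₂, hM₂, hbound⟩ := hbound
    -- From size `3` on, the bound is at least `1` and absorbs the constant `K`.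
    refine ⟨∑ i, cs i + c₂ + 3, ∑ i, Ms i + (M₁ * M₂ + K),
      add_nonneg (Finset.sum_nonneg fun i _ => hMs i) (by positivity),
      fun ρ σ k v C hρ hσ hk hr => ?_⟩
    have hσg : σ g = some (impl g) := hσ.aux g (by simp [hG₀])
    simp only [Term.subst, hσg, Option.getD_some] at hr
    obtain ⟨g', ys, t, hp⟩ := hI.1
    rw [hp] at hr
    obtain ⟨vs, k', C₁, C₂, hA, hk', hR, rfl⟩ := hr.app_inv
    rw [← hp] at hR
    obtain ⟨hvs, hC⟩ := hA.sound hα ih hρ hσ hk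
    obtain ⟨hin, hres⟩ := hG ρ hρ vs ⟨fun i => (hvs i).1, hsub ρ hρ vs hvs⟩
    have hE := Term.evals_iff_exists_runs.2 ⟨k', hR⟩
    obtain ⟨hv, hv'⟩ := hI.2.2.1 vs hin v C₂ hE
    refine ⟨⟨hresBase ▸ hv, vs, hres v hv hv', hvs⟩, fun hu => ?_⟩
    have e₁ := hC (by omega)
    have e₂ := hcost vs hin v C₂ hE
    rw [hsize] at e₂
    have e₃ := mul_le_mul_of_nonneg_left (hbound ρ hρ vs hvs (by omega)) hM₁
    have e₄ := mul_le_mul_of_nonneg_left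
      (α.bound.one_le_eval (u := Γ.size ρ) (by omega)) hK
    push_cast
    linarith
  | @recApp G hG args φ cs₁ cs₂ c ϕ ψ αs hα hargs hsub hsize ih =>
    choose cs Ms hMs ih using ih
    obtain ⟨hargBase, hresBase, hsz, hO, hG⟩ := hG
    refine ⟨∑ i, cs i, ∑ i, Ms i, Finset.sum_nonneg fun i _ => hMs i,
      fun ρ σ k v C hρ hσ hk hr => ?_⟩
    simp only [Term.subst, hσ.recFun, Option.getD_some] at hr
    obtain ⟨f', ys, t, hp⟩ := hΓ.isFix
    rw [hp] at hr
    obtain ⟨vs, k', C₁, C₂, hA, hk', hR, rfl⟩ := hr.app_inv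
    rw [← hp] at hR
    obtain ⟨hvs, hC⟩ := hA.sound hα ih hρ hσ hk
    obtain ⟨hin, hres⟩ := hG ρ hρ vs ⟨fun i => (hvs i).1, hsub ρ hρ vs hvs⟩
    obtain ⟨hv, hv'⟩ := hk k' hk' vs hin v C₂ hR
    refine ⟨⟨hresBase ▸ hv, vs, hres v hv hv', hvs⟩, fun hu => ?_⟩
    have e₁ := hC hu
    have e₂ : C₂ ≤ extendZero T (ϕ (Γ.size ρ)) := by
      refine (hΓ.cost vs hin k' v C₂ hR).trans ?_
      have := extendZero_mono hΓ.mono (hsize ρ hρ vs hvs)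
      rwa [← hsz] at this
    have e₃ : (C₂ : ℝ) ≤ (extendZero T (ϕ (Γ.size ρ)) : ℕ) := by exact_mod_cast e₂
    have e₄ : callCost T (cs₁ ++ (c + 1, ϕ) :: cs₂) (Γ.size ρ) =
        callCost T (cs₁ ++ (c, ϕ) :: cs₂) (Γ.size ρ) + extendZero T (ϕ (Γ.size ρ)) := by
      simp only [callCost, List.map_append, List.map_cons, List.sum_append, List.sum_cons]
      ring
    simp only [e₄]
    push_cast
    linarith

/-- Soundness for branching terms. The type `τ` is not changed when a branch binds variables, so
it must not depend on names that are not bound in `Γ`. -/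
theorem Typing.sound {e : Term L.toDataSig} {τ : RType L.toDataSig} {α : Ann}
    (h : Typing L Γ e τ α) (hΓ : Γ.Interpreted impl p T)
    (hargs : ∀ i, Γ.args i ∈ Γ.vars.map Prod.fst)
    (hτ : ∀ ρ ρ', (∀ x ∈ Γ.vars.map Prod.fst, ρ' x = ρ x) → ∀ v, τ.ref ρ' v → τ.ref ρ v) :
    ∃ (c : ℕ) (M : ℝ), 0 ≤ M ∧ Sound Γ impl p T (Γ.StableInst L) e τ α c M := by
  induction h with
  | elim he =>
    obtain ⟨c, M, hM, h⟩ := he.sound hΓ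
    exact ⟨c, M, hM, fun ρ σ k v C hρ => h ρ σ k v C hρ.inst⟩
  | @ite Γ e t₁ t₂ τ φ α α₁ α₂ hα he h₁ h₂ ih₁ ih₂ =>
    obtain ⟨c, M, hM, h⟩ := he.sound hΓ
    obtain ⟨c₁, M₁, hM₁, ih₁⟩ := ih₁ ⟨hΓ.impl, hΓ.isFix, hΓ.mono, hΓ.cost⟩ hargs hτ
    obtain ⟨c₂, M₂, hM₂, ih₂⟩ := ih₂ ⟨hΓ.impl, hΓ.isFix, hΓ.mono, hΓ.cost⟩ hargs hτ
    refine ⟨c + c₁ + c₂, M + (M₁ + M₂), by positivity, fun ρ σ k v C hρ hσ hk hr => ?_⟩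
    obtain ⟨b, k₁, k₂, C₁, C₂, hk₁, hk₂, hg, hb, rfl⟩ := Runs.ite_inv hr
    have hC₁ := (h ρ σ k₁ (.bool b) C₁ hρ.inst hσ (hk.anti hk₁) hg).2
    -- The guard does not depend on unbound names, so the path condition holds stably.
    have hstable : (Γ.assume fun ρ => φ ρ (.bool b)).StableInst L ρ := by
      intro ρ' hρ'
      refine ⟨(hρ ρ' hρ').1, fun q hq => ?_⟩
      rcases List.mem_cons.1 hq with rfl | hq
      · exact (h ρ' σ k₁ (.bool b) C₁ (hρ ρ' hρ') (hσ.congr hρ') (hk.anti hk₁) hg).1.2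
      · exact (hρ ρ' hρ').2 q hq
    have hbr : (L.HasBase v τ.base ∧ τ.ref ρ v) ∧ (c₁ + c₂ ≤ Γ.size ρ →
        (C₂ : ℝ) ≤ callCost T α₂.calls (Γ.size ρ) + (M₁ + M₂) * α₂.bound.eval (Γ.size ρ)) := by
      cases b with
      | true =>
        have ih' := ih₁.mono (c' := c₁ + c₂) (M' := M₁ + M₂) (by omega) (by linarith)
        exact ih' ρ σ k₂ v C₂ hstable ⟨hσ.vars, hσ.aux, hσ.recFun, hσ.closed⟩ (hk.anti hk₂) hb
      | false =>
        have ih' := ih₂.mono (c' := c₁ + c₂) (M' := M₁ + M₂) (by omega) (by linarith)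
        exact ih' ρ σ k₂ v C₂ hstable ⟨hσ.vars, hσ.aux, hσ.recFun, hσ.closed⟩ (hk.anti hk₂) hb
    exact ⟨hbr.1, fun hu => hα.cost_branch (hC₁ (by omega)) (hbr.2 (by omega))⟩
  | @mtch Γ d e ys br τ φ α α₁ α₂ hα he hinj hfresh hbr ih =>
    obtain ⟨c, M, hM, h⟩ := he.sound hΓ
    have hsub : ∀ (c : L.Ctor d), ∀ x ∈ Γ.vars.map Prod.fst,
        x ∈ (bindings (ys c) (L.argBase c) (L.argRef c) ++ Γ.vars).map Prod.fst := by
      intro c x hx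
      rw [List.map_append]
      exact List.mem_append_right _ hx
    choose cs Ms hMs ih using fun c => ih c ⟨hΓ.impl, hΓ.isFix, hΓ.mono, hΓ.cost⟩
      (fun i => hsub c _ (hargs i)) (fun ρ ρ' hρ => hτ ρ ρ' fun x hx => hρ x (hsub c x hx))
    -- The constants for the finitely many branches are added up.
    have := L.finite_ctor d
    have := Fintype.ofFinite (L.Ctor d)
    have hM0 : 0 ≤ ∑ c, Ms c := Finset.sum_nonneg fun c _ => hMs c
    refine ⟨c + ∑ c, cs c, M + ∑ c, Ms c, by positivity, fun ρ σ k v C hρ hσ hk hr => ?_⟩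
    obtain ⟨c₀, zs, k₁, k₂, C₁, C₂, hk₁, hk₂, hs, hb, rfl⟩ := Runs.mtch_inv hr
    have hfr : ∀ j, ∀ x ∈ Γ.vars.map Prod.fst, ys c₀ j ≠ x := by
      rintro j x hx rfl
      exact hfresh c₀ j (.inr (.inr hx))
    obtain ⟨⟨hzs, -⟩, hC₁⟩ := h ρ σ k₁ (.con c₀ zs) C₁ hρ.inst hσ (hk.anti hk₁) hs
    simp only [DataDecl.HasBase, true_and] at hzs
    rw [Term.subst_subst _ (hσ.closed.without _)] at hb
    set σ' := (σ.without (Set.range (ys c₀))).comp (.ofVals (ys c₀) zs) with hσ'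
    have hσ'ys : ∀ j, σ' (ys c₀ j) = some (zs j).toTerm := fun j => by
      rw [hσ', Subst.comp_of_none (by simp [Subst.without]), Subst.ofVals_apply (hinj c₀)]
    have hσ'of : ∀ y s, (∀ j, ys c₀ j ≠ y) → σ y = some s → σ' y = some s := by
      intro y s hy hs
      rw [hσ', Subst.comp_of_some (s := s)]
      simpa [Subst.without, hy] using hs
    obtain ⟨ρ', hρ'ys, hρ'⟩ : ∃ ρ' : Valuation L.toDataSig, (∀ j, ρ' (ys c₀ j) = zs j) ∧
        ∀ x ∈ Γ.vars.map Prod.fst, ρ' x = ρ x :=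
      ⟨Function.extend (ys c₀) zs ρ, (hinj c₀).extend_apply _ _,
        fun x hx => Function.extend_apply' _ _ _ fun ⟨j, hj⟩ => hfr j x hx hj⟩
    have hsize : Γ.size ρ' = Γ.size ρ := by
      simp only [Env.size, hρ' _ (hargs _)]
    have hbrRuns := ((ih c₀).mono (Finset.single_le_sum (fun _ _ => Nat.zero_le _)
      (Finset.mem_univ c₀)) (Finset.single_le_sum (fun c _ => hMs c) (Finset.mem_univ c₀)))
      ρ' σ' k₂ v C₂ ?_ ?_ (hk.anti hk₂) hb
    · obtain ⟨⟨hv, hv'⟩, hC₂⟩ := hbrRuns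
      refine ⟨⟨hv, hτ ρ ρ' hρ' v hv'⟩, fun hu => hα.cost_branch (hC₁ (by omega)) ?_⟩
      rw [← hsize]
      exact hC₂ (by change _ ≤ Γ.size ρ'; omega)
    · intro ρ'' hρ''
      simp only [Env.assume, Env.bind, List.map_append, List.mem_append,
        mem_map_fst_bindings] at hρ''
      have hys'' : ∀ j, ρ'' (ys c₀ j) = zs j := fun j => by
        rw [hρ'' _ (.inl ⟨j, rfl⟩), hρ'ys]
      have hv'' : ∀ x ∈ Γ.vars.map Prod.fst, ρ'' x = ρ x := fun x hx => by
        rw [hρ'' x (.inr hx), hρ' x hx]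
      refine ⟨fun b hb => ?_, fun q hq => ?_⟩
      · rcases List.mem_append.1 hb with hb | hb
        · obtain ⟨j, rfl⟩ := List.mem_ofFn.1 hb
          simp only [hys'', Function.update_eq_self]
          exact ⟨hzs.1 j, hzs.2 j⟩
        · exact (hρ ρ'' hv'').1 b hb
      · rcases List.mem_cons.1 hq with rfl | hq
        · simp only [hys'']
          exact (h ρ'' σ k₁ (.con c₀ zs) C₁ (hρ ρ'' hv'') (hσ.congr hv'') (hk.anti hk₁) hs).1.2
        · exact (hρ ρ'' hv'').2 q hq
    · refine ⟨fun x hx => ?_, fun g hg => ?_, ?_, (hσ.closed.without _).comp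
        (Subst.closed_ofVals _ _)⟩
      · simp only [Env.assume, Env.bind, List.map_append, List.mem_append,
          mem_map_fst_bindings] at hx
        rcases hx with ⟨j, rfl⟩ | hx
        · rw [hσ'ys, hρ'ys]
        · rw [hρ' x hx]
          exact hσ'of x _ (fun j => hfr j x hx) (hσ.vars x hx)
      · refine hσ'of g _ ?_ (hσ.aux g hg)
        rintro j rfl
        exact hfresh c₀ j (.inr (.inl hg))
      · refine hσ'of _ _ ?_ hσ.recFun
        intro j hj
        exact hfresh c₀ j (.inl hj)

end Soundness

/-! ### The body of a recursive function -/

section Body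

variable {L : DataDecl} {aux : Var → Option (Σ n, FnType L.toDataSig n)}
  {impl : Var → Term L.toDataSig} {f : Var} {n : ℕ} {xs : Fin n → Var} {t : Term L.toDataSig}
  {F : FnType L.toDataSig n}

theorem closed_auxSubst (himpl : ∀ g, (aux g).isSome → (impl g).fv = ∅) :
    (auxSubst aux impl).Closed := by
  intro y s hy
  unfold auxSubst at hy
  split_ifs at hy with h
  obtain rfl := Option.some.inj hy
  exact himpl y h

/-- A function all of whose free names are in the environment becomes closed when the
implementations of the auxiliary functions are substituted. -/
theorem fv_fix_subst_auxSubst (himpl : ∀ g, (aux g).isSome → (impl g).fv = ∅)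
    (ht : t.fv ⊆ (bodyEnv aux f F xs).dom) :
    ((Term.fix f xs t).subst (auxSubst aux impl)).fv = ∅ := by
  refine Set.eq_empty_of_forall_notMem fun y hy => ?_
  obtain ⟨hy, hσ⟩ := Term.fv_subst_subset _ (closed_auxSubst himpl) hy
  obtain ⟨hy, hn⟩ := hy
  rcases ht hy with h | h | h
  · exact hn (.inl h)
  · replace h : (aux y).isSome := h
    simp [auxSubst, h] at hσ
  · exact hn (.inr (mem_map_fst_bindings.1 h))

/-- A run of a call `f(zs)` contains a shorter run of the body under the substitution given by
`zs`. -/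
theorem Runs.exists_body (hxs : Function.Injective xs) (hfxs : ∀ i, xs i ≠ f)
    (hauxf : aux f = none) (hauxxs : ∀ i, aux (xs i) = none)
    (himpl : ∀ g, (aux g).isSome → (impl g).fv = ∅)
    (ht : t.fv ⊆ (bodyEnv aux f F xs).dom) {k : ℕ} {zs : Fin n → Val L.toDataSig}
    (hzs : F.IsInput L zs) {v : Val L.toDataSig} {C : ℕ}
    (hr : Runs k (.app ((Term.fix f xs t).subst (auxSubst aux impl)) fun i => (zs i).toTerm) v C) :
    ∃ k' < k, ∃ ρ σ, (bodyEnv aux f F xs).StableInst L ρ ∧ (fun i => ρ (xs i)) = zs ∧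
      (bodyEnv aux f F xs).Realizes impl ((Term.fix f xs t).subst (auxSubst aux impl)) ρ σ ∧
      Runs k' (t.subst σ) v C := by
  have hp := fv_fix_subst_auxSubst himpl ht
  set p := (Term.fix f xs t).subst (auxSubst aux impl) with hpdef
  have hcl := (closed_auxSubst himpl).without (insert f (Set.range xs))
  obtain ⟨k', hk', hb⟩ := Runs.unfold hr
  rw [Term.subst_subst _ hcl] at hb
  obtain ⟨ρ, hρ⟩ : ∃ ρ : Valuation L.toDataSig, ∀ i, ρ (xs i) = zs i :=
    ⟨Function.extend xs zs fun _ => .int 0, hxs.extend_apply _ _⟩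
  refine ⟨k', hk', ρ, _, ?_, funext hρ, ?_, hb⟩
  · intro ρ' hρ'
    have h : ∀ i, ρ' (xs i) = zs i := fun i =>
      (hρ' _ (mem_map_fst_bindings.2 ⟨i, rfl⟩)).trans (hρ i)
    refine ⟨fun b hb => ?_, fun q hq => by simp [bodyEnv] at hq⟩
    obtain ⟨j, rfl⟩ := List.mem_ofFn.1 hb
    simp only [h, Function.update_eq_self]
    exact ⟨hzs.1 j, hzs.2 j⟩
  · refine ⟨fun x hx => ?_, fun g hg => ?_, ?_, hcl.comp ?_⟩
    · obtain ⟨i, rfl⟩ := mem_map_fst_bindings.1 hx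
      rw [hρ i, Subst.comp_of_none (by simp [Subst.without])]
      simp [Subst.unfold, Subst.ofVals_apply hxs]
    · replace hg : (aux g).isSome := hg
      refine Subst.comp_of_some ?_
      have h₁ : g ≠ f := by rintro rfl; simp [hauxf] at hg
      have h₂ : ∀ i, xs i ≠ g := by rintro i rfl; simp [hauxxs] at hg
      simp [Subst.without, auxSubst, h₁, h₂, hg]
    · rw [Subst.comp_of_none (by simp [Subst.without, bodyEnv])]
      simp only [Subst.unfold, bodyEnv, Subst.ofVals_of_notMem zs hfxs]
      rfl
    · intro y s hy
      cases h : Subst.ofVals xs zs y with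
      | some s' =>
        obtain rfl : s' = s := by simpa [Subst.unfold, h] using hy
        exact Subst.closed_ofVals _ _ _ _ h
      | none =>
        simp only [Subst.unfold, h, Option.orElse_none] at hy
        split_ifs at hy
        rw [← Option.some.inj hy]
        exact hp

/-- Results of recursive calls have the result type: strong induction on the number of steps, since
the calls in the body belong to a shorter run. -/
theorem recSound_bodyEnv (hxs : Function.Injective xs) (hfxs : ∀ i, xs i ≠ f)
    (hauxf : aux f = none) (hauxxs : ∀ i, aux (xs i) = none)
    (himpl : ∀ g, (aux g).isSome → (impl g).fv = ∅)
    (ht : t.fv ⊆ (bodyEnv aux f F xs).dom) {T : ℕ → ℕ} {α : Ann} {c : ℕ} {M : ℝ}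
    (h : Sound (bodyEnv aux f F xs) impl ((Term.fix f xs t).subst (auxSubst aux impl)) T
      ((bodyEnv aux f F xs).StableInst L) t (bodyType F xs) α c M) (k : ℕ) :
    (bodyEnv aux f F xs).RecSound ((Term.fix f xs t).subst (auxSubst aux impl)) k := by
  induction k using Nat.strong_induction_on with
  | _ k ih =>
    intro j hj zs hzs v C hr
    obtain ⟨k', hk', ρ, σ, hρ, rfl, hσ, hb⟩ :=
      Runs.exists_body hxs hfxs hauxf hauxxs himpl ht hzs hr
    exact (h ρ σ k' v C hρ hσ (ih k' (by omega)) hb).1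

theorem satisfiesRecurrence_of_typing
    (himpl : ∀ (g : Var) (k : ℕ) (G : FnType L.toDataSig k),
      aux g = some ⟨k, G⟩ → G.Implements L (impl g))
    (hxs : Function.Injective xs) (hfxs : ∀ i, xs i ≠ f)
    (hauxf : aux f = none) (hauxxs : ∀ i, aux (xs i) = none) {α : Ann}
    (ht : Typing L (bodyEnv aux f F xs) t (bodyType F xs) α) {T : ℕ → ℕ}
    (hT : IsComplexity L F ((Term.fix f xs t).subst (auxSubst aux impl)) T)
    (hmono : Monotone T) : SatisfiesRecurrence T α := by
  have himpl' : ∀ g, (aux g).isSome → (impl g).fv = ∅ := by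
    intro g hg
    obtain ⟨⟨k, G⟩, hG⟩ := Option.isSome_iff_exists.1 hg
    exact (himpl g k G hG).2.1
  have hΓ : (bodyEnv aux f F xs).Interpreted impl
      ((Term.fix f xs t).subst (auxSubst aux impl)) T :=
    { impl := himpl
      isFix := ⟨f, xs, _, rfl⟩
      mono := hmono
      cost := fun zs hzs k v C hr =>
        (hT.2 _).1 ⟨zs, hzs, rfl, v, Term.evals_iff_exists_runs.2 ⟨k, hr⟩⟩ }
  obtain ⟨c, M, hM, h⟩ := ht.sound hΓ (fun i => mem_map_fst_bindings.2 ⟨i, rfl⟩) <| by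
    intro ρ ρ' hρ v hv
    have : (fun i => ρ' (xs i)) = fun i => ρ (xs i) :=
      funext fun i => hρ _ (mem_map_fst_bindings.2 ⟨i, rfl⟩)
    simpa only [bodyType, this] using hv
  have hrec := recSound_bodyEnv hxs hfxs hauxf hauxxs himpl' ht.fv_subset h
  refine ⟨fun u => T u - callCost T α.calls u, ⟨c, M, hM, fun u hu => ?_⟩, fun u => ?_⟩
  · have hB : 0 ≤ M * α.bound.eval u := mul_nonneg hM (α.bound.eval_nonneg u)
    -- The supremum `T u` is a natural number, so the real bound is rounded down.
    have hle : T u ≤ callCost T α.calls u + ⌊M * α.bound.eval u⌋₊ := by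
      refine (hT.2 u).2 ?_
      rintro C ⟨zs, hzs, rfl, v, hE⟩
      obtain ⟨k, hr⟩ := Term.evals_iff_exists_runs.1 hE
      obtain ⟨k', -, ρ, σ, hρ, rfl, hσ, hb⟩ :=
        Runs.exists_body hxs hfxs hauxf hauxxs himpl' ht.fv_subset hzs hr
      have hC := (h ρ σ k' v C hρ hσ (hrec k') hb).2 hu
      rw [add_comm, ← Nat.floor_add_natCast hB, add_comm]
      exact Nat.le_floor hC
    calc ((T u - callCost T α.calls u : ℕ) : ℝ) ≤ (⌊M * α.bound.eval u⌋₊ : ℕ) := by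
          exact_mod_cast (by omega : T u - callCost T α.calls u ≤ ⌊M * α.bound.eval u⌋₊)
      _ ≤ M * α.bound.eval u := Nat.floor_le hB
  · change T u ≤ callCost T α.calls u + (T u - callCost T α.calls u)
    omega

end Body

end SynPlexity

theorem mainTheorem2 (L : SynPlexity.DataDecl)
    (aux : SynPlexity.Var → Option (Σ n, SynPlexity.FnType L.toDataSig n))
    (impl : SynPlexity.Var → SynPlexity.Term L.toDataSig)
    (himpl : ∀ (g : SynPlexity.Var) (k : ℕ) (G : SynPlexity.FnType L.toDataSig k),
      aux g = some ⟨k, G⟩ → G.Implements L (impl g))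
    (f : SynPlexity.Var) (n : ℕ) (xs : Fin n → SynPlexity.Var)
    (t : SynPlexity.Term L.toDataSig) (F : SynPlexity.FnType L.toDataSig n)
    (hxs : Function.Injective xs) (hfxs : ∀ i, xs i ≠ f)
    (hauxf : aux f = none) (hauxxs : ∀ i, aux (xs i) = none)
    (α : SynPlexity.Ann)
    (ht : SynPlexity.Typing L (SynPlexity.bodyEnv aux f F xs) t (SynPlexity.bodyType F xs) α)
    (T : ℕ → ℕ)
    (hT : SynPlexity.IsComplexity L F
      ((SynPlexity.Term.fix f xs t).subst (SynPlexity.auxSubst aux impl)) T)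
    (hmono : Monotone T) :
    SynPlexity.SatisfiesRecurrence T α :=
  SynPlexity.satisfiesRecurrence_of_typing himpl hxs hfxs hauxf hauxxs ht hT hmono
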